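/- Let $\mathcal A$ be a countable (finite or infinite) set with at least two elements, and let $\mathbf P$ be the law on $\mathcal A^{\mathbb Z}$ of a stationary process $(X_j)_{j\in\mathbb Z}$. Let $p(a\mid x)$, $a\in\mathcal A$, $x\in\mathcal A^{\{-1,-2,\dots\}}$, be a regular version (a probability kernel) of the conditional probabilities $\mathbf P(X_0=a\mid X_{-1},X_{-2},\dots)$, put, for $j\ge 0$, $$\mathrm{Var}_j(p)=\sup\Big\{\tfrac12\sum_{a\in\mathcal A}|p(a\mid x)-p(a\mid y)| : x_i=y_i \text{ for } -j\le i\le -1\Big\},\qquad \Gamma=\prod_{j=0}^{\infty}\big(1-\mathrm{Var}_j(p)\big),$$ and assume $\Gamma>0$. Let $D,G\subset\mathbb Z$ be finite with $\min(G\cup D)=1$, and put $L=\max(G\cup D)-\min(G\cup D)+1$ and $K=|G|+|D|$. Define $$\delta(b)=\inf\Big\{\mathbf P(X_G\ne c,X_D=b)-\inf_{a\in\mathcal A^G}\mathbf P(X_G\ne a,X_D=b)>0 : c\in\mathcal A^G\Big\}\quad(b\in\mathcal A^D),$$ with $\delta(b)=0$ if this set is empty, $\delta=\inf_{b\in\mathcal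 A^D}\delta(b)$, and $$\beta=\sup_{b\in\mathcal A^D}\Big(\sup_{a\in\mathcal A^G}\mathbf P(X_G=a,X_D=b)-\inf_{c\in\mathcal A^G}\mathbf P(X_G=c,X_D=b)\Big).$$ For a sample $x_1^n=(x_1,\dots,x_n)$, let $N^n(b,a)$ be the number of $0\le i\le n-1$ such that $D+i$ and $G+i$ are contained in $\{1,\dots,n\}$, $x_{D+i}=b$ and $x_{G+i}=a$. Let $\hat f^n$ be the estimator $\hat f^n[x_1^n](b)\in\operatorname{argmax}_{a\in\mathcal A^G}N^n(b,a)/n$, where ties are broken by an arbitrary rule. Its excess risk is $$R(\hat f^n)=\sup_{b\in\mathcal A^D}\Big(\widetilde{\mathbf P}\big(\hat f^n[X_1^n](Y_D)\ne Y_G\mid Y_D=b\big)-\inf_{a\in\mathcal A^G}\widetilde{\mathbf P}\big(a\ne Y_G\mid Y_D=b\big)\Big)\,\widetilde{\mathbf P}(Y_D=b),$$ where $(X,Y)$ has law $\widetilde{\mathbf P}=\mathbf P\otimes\mathbf P$, and a pattern $b$ of probability $0$ contributes $0$. Let $\varepsilon>0$. If $$n\ \ge\ \frac{4}{\big(\frac{\varepsilon}{2}\vee\delta\big)^{2}}\left(\Big(\frac{K}{\Gamma}\Big)^{2}\log\Big(\frac{2\beta}{\varepsilon}\Big)+\frac{4K(1-\Gamma)}{\Gamma}+2\right)+L-2$$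 (where $\log 0$ is read as $0$ in the trivial case $\beta=0$), then $$R(\hat f^n)\ \le\ \varepsilon\wedge\beta .$$ In particular, the bound does not involve the size of the alphabet $\mathcal A$. -/

import Mathlib

open MeasureTheory ProbabilityTheory

noncomputable section

namespace Guessing

variable {A : Type*}

/-! ### Finite windows and counting -/

/-- The diameter `max H - min H + 1` of a nonempty finite set of integers (`0` for `∅`). -/
def diam (H : Finset ℤ) : ℤ :=
  if h : H.Nonempty then H.max' h - H.min' h + 1 else 0

/-- Samples `x_1, …, x_n`. -/
abbrev Sample (A : Type*) (n : ℕ) : Type _ := Finset.Icc (1 : ℤ) (n : ℤ) → A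

/-- The sample `(x_1, …, x_n)` read off a bi-infinite sequence. -/
def sample (n : ℕ) (x : ℤ → A) : Sample A n := (Finset.Icc (1 : ℤ) (n : ℤ)).restrict x

/-- `H + i ⊆ {1, …, n}` and the sample carries the pattern `w` on `H + i`. -/
def OccursAt {n : ℕ} {H : Finset ℤ} (x : Sample A n) (w : H → A) (i : ℤ) : Prop :=
  ∀ j : H, ∃ h : (j : ℤ) + i ∈ Finset.Icc (1 : ℤ) (n : ℤ), x ⟨(j : ℤ) + i, h⟩ = w j

open Classical in
/-- The number of shifts `0 ≤ i ≤ n - 1` at which `b` occurs on `D + i` and `a` on `G + i`. -/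
def count {n : ℕ} {D G : Finset ℤ} (x : Sample A n) (b : D → A) (a : G → A) : ℕ :=
  ∑ i ∈ Finset.range n, if OccursAt x b (i : ℤ) ∧ OccursAt x a (i : ℤ) then 1 else 0

/-- `f` is a version of the estimator `f[x](b) ∈ argmax_a N(b, a) / n`
(with an arbitrary rule for breaking ties). -/
def IsArgmaxEstimator {n : ℕ} {D G : Finset ℤ}
    (f : Sample A n → (D → A) → (G → A)) : Prop :=
  ∀ (x : Sample A n) (b : D → A) (a : G → A),
    (count x b a : ℝ) / n ≤ (count x b (f x b) : ℝ) / n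

/-! ### Stationarity, left conditional probabilities, and the constant `Γ` -/

/-- Pasts: sequences indexed by `{-1, -2, …}`. -/
abbrev Pasts (A : Type*) : Type _ := {i : ℤ // i < 0} → A

/-- The past `x_{-∞}^{-1}` of a bi-infinite sequence. -/
def leftPast (x : ℤ → A) : Pasts A := fun i => x i

variable [MeasurableSpace A]

/-- The law `P` on `A^ℤ` is invariant under the shift. -/
def IsStationary (P : Measure (ℤ → A)) : Prop :=
  MeasurePreserving (fun (x : ℤ → A) (k : ℤ) => x (k + 1)) P P

/-- The probability kernel `p(a | x)` is a regular version of the conditional probabilities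
`P(X_0 = a | X_{-1}, X_{-2}, …)`. -/
def IsLeftCondProb (P : Measure (ℤ → A)) (p : Kernel (Pasts A) A) : Prop :=
  ∀ a : A,
    P[Set.indicator {x : ℤ → A | x 0 = a} (fun _ => (1 : ℝ)) |
        MeasurableSpace.comap (leftPast (A := A)) MeasurableSpace.pi]
      =ᵐ[P] fun x => (p (leftPast x)).real {a}

/-- `Var_n(p)`: the largest total variation distance between `p(· | x)` and `p(· | y)` over pasts
that agree at the times `-n, …, -1` (no restriction for `n = 0`). -/
def variation (p : Kernel (Pasts A) A) (n : ℕ) : ℝ :=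
  sSup {v : ℝ | ∃ x y : Pasts A, (∀ i : {i : ℤ // i < 0}, -(n : ℤ) ≤ (i : ℤ) → x i = y i) ∧
    v = (1 / 2 : ℝ) * ∑' a : A, |(p x).real {a} - (p y).real {a}|}

/-- `Γ = ∏_{j ≥ 0} (1 - Var_j(p))`. All factors lie in `[0, 1]`, so the product converges. -/
def gammaConst (p : Kernel (Pasts A) A) : ℝ := ∏' j : ℕ, (1 - variation p j)

/-! ### Margin, spread and excess risk -/

/-- `P(X_G ≠ c, X_D = b)`. -/
def missProb (P : Measure (ℤ → A)) {D G : Finset ℤ} (b : D → A) (c : G → A) : ℝ :=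
  P.real {x | G.restrict x ≠ c ∧ D.restrict x = b}

/-- `P(X_G = c, X_D = b)`. -/
def hitProb (P : Measure (ℤ → A)) {D G : Finset ℤ} (b : D → A) (c : G → A) : ℝ :=
  P.real {x | G.restrict x = c ∧ D.restrict x = b}

/-- `δ_{D,G}(b)`: infimum of the positive gaps, `0` if there is none (`sInf ∅ = 0` in `ℝ`). -/
def marginAt (P : Measure (ℤ → A)) {D : Finset ℤ} (G : Finset ℤ) (b : D → A) : ℝ :=
  sInf {g : ℝ | 0 < g ∧
    ∃ c : G → A, g = missProb P b c - ⨅ a : G → A, missProb P b a}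

/-- The margin `δ_{D,G}`. -/
def margin (P : Measure (ℤ → A)) (D G : Finset ℤ) : ℝ :=
  ⨅ b : D → A, marginAt P G b

/-- `β_{D,G}`. -/
def spread (P : Measure (ℤ → A)) (D G : Finset ℤ) : ℝ :=
  ⨆ b : D → A, ((⨆ a : G → A, hitProb P b a) - ⨅ c : G → A, hitProb P b c)

/-- The excess risk of `f`. Under `P ⊗ P` the first coordinate is the process `X` that supplies the
sample, and the second one is the independent copy `Y`. A pattern `b` with `P(Y_D = b) = 0`
contributes `0`. -/
def excessRisk (P : Measure (ℤ → A)) {n : ℕ} {D G : Finset ℤ}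
    (f : Sample A n → (D → A) → (G → A)) : ℝ :=
  ⨆ b : D → A,
    (((P.prod P)[|{z | D.restrict z.2 = b}]).real
          {z | f (sample n z.1) (D.restrict z.2) ≠ G.restrict z.2}
        - ⨅ a : G → A, ((P.prod P)[|{z | D.restrict z.2 = b}]).real {z | a ≠ G.restrict z.2})
      * (P.prod P).real {z | D.restrict z.2 = b}

end Guessing

end

/-! The excess risk at a pattern `b` is the mean of the gap between the hit probability of the best
guess `a₀` and that of the estimator's guess. Write `Z a` for the centred counts and `m = n - L + 1`
for the number of shifts. Since the estimator maximises the counts, `m` times the gap is at most `W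
= sup_a (Z a - Z a₀)`. So it suffices to control the mean and the upper tail of `W`, without any
cost in the size of the alphabet.

Concentration: two copies of the chain whose pasts share the last `s` symbols can draw the same next
symbol except with probability at most `Var_s(p)`. Their agreement length is thus controlled by a
house-of-cards chain, whose expected number of visits to 0 is at most `1 / Γ`
(`mul_sum_houseProb_le`). By Young's inequality the oscillations of the k-step expectations have
square sum at most `S / Γ ^ 2`, where `S` bounds the square sum of the one-symbol oscillations of
the function. Hoeffding's lemma applied step by step, together with invariance of the law of the
past, then yields `integral_exp_le`. For `W`, changing one symbol costs at most twice the number of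
windows covering it, which gives variance proxy `τ ^ 2 = (K / Γ) ^ 2 * m`.

Mean: at each shift at most one `a` occurs, so every signed sum of the counts obeys the same
concentration bound. Averaging over signs bounds the sum over `a` of the variances by `τ ^ 2`
(`sum_variance_count_le`), and hence the mean of `W` by `τ` (`integral_deviation_le`); no union
bound over the alphabet is used.

Conclusion: if `δ ≤ ε / 2`, the mean gap is at most `τ / m ≤ ε`. Otherwise a nonzero gap is at least
`δ`, so it forces `W ≥ m * δ`; this has probability at most `ε / β` by the tail bound, and the gap
never exceeds `β`. -/

namespace Guessing

/-! ### The house-of-cards chain -/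

/-- For the chain on `ℕ` that moves from `s` to `s + 1` with probability `1 - V s` and to `0` with
probability `V s`: the probability of being at `0` at time `l`, started from `s`. -/
noncomputable def houseProb (V : ℕ → ℝ) : ℕ → ℕ → ℝ
  | 0, s => if s = 0 then 1 else 0
  | l + 1, s => (1 - V s) * houseProb V l (s + 1) + V s * houseProb V l 0

variable {V : ℕ → ℝ}

theorem houseProb_nonneg (h0 : ∀ s, 0 ≤ V s) (h1 : ∀ s, V s ≤ 1) (l : ℕ) :
    ∀ s, 0 ≤ houseProb V l s := by
  induction l with
  | zero => intro s; simp only [houseProb]; split_ifs <;> norm_num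
  | succ l ih =>
    intro s
    have := mul_nonneg (sub_nonneg.2 (h1 s)) (ih (s + 1))
    have := mul_nonneg (h0 s) (ih 0)
    simp only [houseProb]; linarith

/-- The increment at time `l + 1` splits into `(1 - V (s + 1))` times an increment at time `l`, plus
`(V s - V (s + 1))` times the advantage of a start at 0; both parts have a sign. -/
theorem houseProb_antitone (h1 : ∀ s, V s ≤ 1) (hV : Antitone V) (l : ℕ) :
    Antitone (houseProb V l) := by
  induction l with
  | zero =>
    refine antitone_nat_of_succ_le fun s => ?_
    by_cases hs : s = 0 <;> simp [houseProb, hs]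
  | succ l ih =>
    refine antitone_nat_of_succ_le fun s => ?_
    simp only [houseProb]
    have a := ih (show s + 1 ≤ s + 1 + 1 by omega)
    have b := ih (show 0 ≤ s + 1 by omega)
    have c := hV (show s ≤ s + 1 by omega)
    have d := mul_nonneg (sub_nonneg.2 (h1 (s + 1))) (sub_nonneg.2 a)
    have e := mul_nonneg (sub_nonneg.2 c) (sub_nonneg.2 b)
    nlinarith

/-- From 0 the chain escapes to infinity without returning with probability at least `Γ`, so the
number of visits to 0 is dominated by a geometric variable of mean `1 / Γ`. The induction proves
this without building the chain. -/
theorem mul_sum_houseProb_le {Γ : ℝ} (hΓ : 0 < Γ) (h0 : ∀ s, 0 ≤ V s) (h1 : ∀ s, V s ≤ 1)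
    (hprod : ∀ s, Γ ≤ ∏ j ∈ Finset.range s, (1 - V j)) (N : ℕ) :
    Γ * ∑ l ∈ Finset.range N, houseProb V l 0 ≤ 1 := by
  set π : ℕ → ℝ := fun s => ∏ j ∈ Finset.range s, (1 - V j) with hπ
  have hπpos : ∀ s, 0 < π s := fun s => hΓ.trans_le (hprod s)
  have hstep : ∀ s, (1 - V s) * (Γ / π (s + 1)) = Γ / π s := fun s => by
    have e : π (s + 1) = π s * (1 - V s) := Finset.prod_range_succ _ _
    have p1 := (hπpos s).ne'
    have p2 := (hπpos (s + 1)).ne'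
    have p3 : 1 - V s ≠ 0 := fun h => p2 (by rw [e, h, mul_zero])
    rw [e]; field_simp
  have hle : ∀ s, Γ / π s ≤ 1 := fun s => (div_le_one (hπpos s)).2 (hprod s)
  -- `Γ / π s` bounds from below the probability of never being reset from height `s`. The visit at
  -- time 0 adds `Γ` when `s = 0`, which exactly cancels `Γ / π 0`.
  have key : ∀ N s, Γ * ∑ l ∈ Finset.range N, houseProb V l s ≤
      if s = 0 then 1 else 1 - Γ / π s := by
    intro N
    induction N with
    | zero => intro s; have := hle s; split_ifs <;> simp [this]
    | succ N ih =>
      intro s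
      have e : Γ * ∑ l ∈ Finset.range (N + 1), houseProb V l s =
          (1 - V s) * (Γ * ∑ l ∈ Finset.range N, houseProb V l (s + 1)) +
            V s * (Γ * ∑ l ∈ Finset.range N, houseProb V l 0) + Γ * (if s = 0 then 1 else 0) := by
        rw [Finset.sum_range_succ']
        simp only [houseProb, Finset.sum_add_distrib, ← Finset.mul_sum]
        ring
      have a := ih (s + 1)
      have b := ih 0
      rw [if_neg (by omega)] at a
      rw [if_pos rfl] at b
      have a' := mul_le_mul_of_nonneg_left a (sub_nonneg.2 (h1 s))
      have b' := mul_le_mul_of_nonneg_left b (h0 s)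
      rw [mul_sub, hstep] at a'
      have hz : Γ / π 0 = Γ := by simp [hπ]
      rw [e]
      split_ifs with hs
      · subst hs; rw [hz] at a'; linarith
      · linarith
  simpa using key N 0

/-- Young's inequality `‖u * v‖₂ ≤ ‖u‖₁ ‖v‖₂` for causal convolutions. -/
theorem sum_sq_convolution_le {u v : ℕ → ℝ} (hu : ∀ i, 0 ≤ u i) {U W : ℝ}
    (hU : ∀ N, ∑ l ∈ Finset.range N, u l ≤ U) (hW : ∀ N, ∑ l ∈ Finset.range N, v l ^ 2 ≤ W)
    (N : ℕ) :
    ∑ k ∈ Finset.range N, (∑ l ∈ Finset.range (k + 1), u l * v (k - l)) ^ 2 ≤ U ^ 2 * W := by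
  have hU0 : 0 ≤ U := by simpa using hU 0
  have h1 : ∀ k, (∑ l ∈ Finset.range (k + 1), u l * v (k - l)) ^ 2 ≤
      U * ∑ l ∈ Finset.range (k + 1), u l * v (k - l) ^ 2 := fun k => by
    have h := Finset.sum_sq_le_sum_mul_sum_of_sq_le_mul (Finset.range (k + 1))
      (r := fun l => u l * v (k - l)) (f := u) (g := fun l => u l * v (k - l) ^ 2)
      (fun i _ => hu i) (fun i _ => mul_nonneg (hu i) (sq_nonneg _)) (fun i _ => (by ring : _ = _).le)
    exact h.trans (mul_le_mul_of_nonneg_right (hU _)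
      (Finset.sum_nonneg fun i _ => mul_nonneg (hu i) (sq_nonneg _)))
  have h2 : ∑ k ∈ Finset.range N, ∑ l ∈ Finset.range (k + 1), u l * v (k - l) ^ 2 ≤ U * W := by
    have e : ∑ k ∈ Finset.range N, ∑ l ∈ Finset.range (k + 1), u l * v (k - l) ^ 2 =
        ∑ l ∈ Finset.range N, ∑ j ∈ Finset.range (N - l), u l * v j ^ 2 := by
      rw [Finset.sum_sigma', Finset.sum_sigma']
      refine Finset.sum_nbij' (fun x => ⟨x.2, x.1 - x.2⟩) (fun x => ⟨x.1 + x.2, x.1⟩) ?_ ?_ ?_ ?_ ?_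
      · rintro ⟨k, l⟩ h; simp at h ⊢; omega
      · rintro ⟨k, l⟩ h; simp at h ⊢; omega
      · rintro ⟨k, l⟩ h; simp at h ⊢; omega
      · rintro ⟨k, l⟩ -; simp
      · rintro ⟨k, l⟩ -; simp
    rw [e]
    calc _ = ∑ l ∈ Finset.range N, u l * ∑ j ∈ Finset.range (N - l), v j ^ 2 := by
          simp only [Finset.mul_sum]
      _ ≤ ∑ l ∈ Finset.range N, u l * W :=
          Finset.sum_le_sum fun l _ => mul_le_mul_of_nonneg_left (hW _) (hu l)
      _ = (∑ l ∈ Finset.range N, u l) * W := by rw [Finset.sum_mul]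
      _ ≤ U * W := mul_le_mul_of_nonneg_right (hU N) (by simpa using hW 0)
  calc _ ≤ ∑ k ∈ Finset.range N, U * ∑ l ∈ Finset.range (k + 1), u l * v (k - l) ^ 2 :=
        Finset.sum_le_sum fun k _ => h1 k
    _ = U * ∑ k ∈ Finset.range N, ∑ l ∈ Finset.range (k + 1), u l * v (k - l) ^ 2 := by
        rw [Finset.mul_sum]
    _ ≤ U * (U * W) := mul_le_mul_of_nonneg_left h2 hU0
    _ = _ := by ring

/-- The discrepancy accumulated after `k` steps by two coupled chains whose pasts initially agree on
the last `s` symbols, a disagreement `j` steps before the end being charged `d j`. -/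
noncomputable def couplingBound (V d : ℕ → ℝ) (k s : ℕ) : ℝ :=
  ∑ l ∈ Finset.range k, houseProb V (l + 1) s * d (k - 1 - l)

theorem couplingBound_succ (V d : ℕ → ℝ) (k s : ℕ) :
    couplingBound V d (k + 1) s = (1 - V s) * couplingBound V d k (s + 1) +
      V s * (couplingBound V d k 0 + d k) := by
  unfold couplingBound
  rw [Finset.sum_range_succ', mul_add, Finset.mul_sum, Finset.mul_sum, ← add_assoc,
    ← Finset.sum_add_distrib]
  congr 1
  · refine Finset.sum_congr rfl fun l _ => ?_
    rw [show k + 1 - 1 - (l + 1) = k - 1 - l by omega]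
    simp only [houseProb]; ring
  · simp [houseProb]

theorem couplingBound_le_zero (h1 : ∀ s, V s ≤ 1) (hV : Antitone V)
    {d : ℕ → ℝ} (hd : ∀ j, 0 ≤ d j) (k s : ℕ) : couplingBound V d k s ≤ couplingBound V d k 0 :=
  Finset.sum_le_sum fun _ _ =>
    mul_le_mul_of_nonneg_right (houseProb_antitone h1 hV _ (Nat.zero_le s)) (hd _)

/-- The charge `d k` is the term of the visit at time 0, so the total is a causal convolution, the
form required by `sum_sq_convolution_le`. -/
theorem couplingBound_zero_add (V d : ℕ → ℝ) (k : ℕ) :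
    couplingBound V d k 0 + d k = ∑ l ∈ Finset.range (k + 1), houseProb V l 0 * d (k - l) := by
  rw [Finset.sum_range_succ']
  simp only [couplingBound, houseProb, if_true, one_mul, Nat.sub_zero]
  congr 1
  refine Finset.sum_congr rfl fun l _ => ?_
  rw [show k - 1 - l = k - (l + 1) by omega]

/-! ### Coupling two distributions -/

variable {A : Type*} [Countable A] [MeasurableSpace A] [DiscreteMeasurableSpace A]

theorem hasSum_real_singleton (μ : Measure A) [IsProbabilityMeasure μ] :
    HasSum (fun a => μ.real {a}) 1 := by
  have h : ∑' a, μ {a} = 1 := by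
    have := lintegral_countable' (μ := μ) (fun _ => 1)
    simpa using this.symm
  have h2 := ENNReal.hasSum_toReal (f := fun a => μ {a}) (by rw [h]; simp)
  rw [← ENNReal.tsum_toReal_eq (fun a => measure_ne_top μ _), h] at h2
  simpa [Measure.real] using h2

theorem hasSum_integral_singleton (μ : Measure A) [IsProbabilityMeasure μ] {f : A → ℝ} {M : ℝ}
    (hf : ∀ a, |f a| ≤ M) : HasSum (fun a => μ.real {a} * f a) (∫ a, f a ∂μ) := by
  have hi : Integrable f μ := Integrable.of_bound (C := M)
    (measurable_of_countable f).aestronglyMeasurable (ae_of_all _ (by simpa using hf))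
  have := hasSum_integral_iUnion (μ := μ) (f := f) (s := fun a : A => {a})
    (fun a => measurableSet_singleton a)
    (fun i j h => by simpa [Function.onFun] using h) (by simpa using hi.integrableOn)
  rwa [Set.iUnion_of_singleton, setIntegral_univ, funext fun a => integral_singleton f a] at this

/-- Comparing expectations through a maximal coupling of `μ` and `ν`. -/
theorem integral_sub_integral_le_of_coupling (μ ν : Measure A) [IsProbabilityMeasure μ]
    [IsProbabilityMeasure ν] {f g : A → ℝ} {M x c V : ℝ} (hf : ∀ a, |f a| ≤ M)
    (hg : ∀ a, |g a| ≤ M) (hx : ∀ a, f a - g a ≤ x) (hc : ∀ a a', f a - g a' ≤ c) (hxc : x ≤ c)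
    (hV : (1 / 2 : ℝ) * ∑' a, |μ.real {a} - ν.real {a}| ≤ V) :
    ∫ a, f a ∂μ - ∫ a, g a ∂ν ≤ (1 - V) * x + V * c := by
  have hne : Nonempty A := μ.nonempty_of_neZero
  -- No coupling is constructed: the common mass `min μ ν` contributes at most `x` per unit, and
  -- only the leftover masses remain to be compared. After subtracting `θ`, the leftover of `ν`
  -- enters with a favourable sign and can be dropped, while the leftover of `μ` costs at most `c`
  -- per unit.
  set θ := ⨅ a, g a with hθ
  have hbdd : BddBelow (Set.range g) := ⟨-M, by rintro _ ⟨a, rfl⟩; exact (abs_le.1 (hg a)).1⟩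
  have hgθ : ∀ a, θ ≤ g a := fun a => ciInf_le hbdd a
  have hfθ : ∀ a, f a - θ ≤ c := fun a => by
    have : f a - c ≤ θ := le_ciInf fun a' => by linarith [hc a a']
    linarith
  have hμ := hasSum_real_singleton μ
  have hν := hasSum_real_singleton ν
  have habs : Summable fun a => |μ.real {a} - ν.real {a}| := (hμ.summable.sub hν.summable).abs
  set v := (1 / 2 : ℝ) * ∑' a, |μ.real {a} - ν.real {a}| with hv
  have hm : HasSum (fun a => min (μ.real {a}) (ν.real {a})) (1 - v) := by
    have h := ((hμ.add hν).sub habs.hasSum).mul_left (1 / 2 : ℝ)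
    rw [show (1 / 2 : ℝ) * (1 + 1 - ∑' a, |μ.real {a} - ν.real {a}|) = 1 - v by rw [hv]; ring] at h
    refine h.congr_fun fun a => ?_
    rcases le_total (μ.real {a}) (ν.real {a}) with h | h
    · rw [min_eq_left h, abs_of_nonpos (by linarith)]; ring
    · rw [min_eq_right h, abs_of_nonneg (by linarith)]; ring
  have hF := (hasSum_integral_singleton μ hf).sub (hμ.mul_right θ)
  have hG := (hasSum_integral_singleton ν hg).sub (hν.mul_right θ)
  have hR := ((hm.mul_right x).add ((hμ.sub hm).mul_right c))
  have hle := hasSum_le (fun a => ?_) (hF.sub hG) hR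
  · have : 0 ≤ (V - v) * (c - x) := mul_nonneg (sub_nonneg.2 hV) (sub_nonneg.2 hxc)
    nlinarith
  · set m := min (μ.real {a}) (ν.real {a})
    have m0 : 0 ≤ m := le_min measureReal_nonneg measureReal_nonneg
    have m1 : m ≤ μ.real {a} := min_le_left _ _
    have m2 : m ≤ ν.real {a} := min_le_right _ _
    have a1 := mul_le_mul_of_nonneg_left (hx a) m0
    have a2 := mul_le_mul_of_nonneg_left (hfθ a) (sub_nonneg.2 m1)
    have a3 := mul_nonneg (sub_nonneg.2 m2) (sub_nonneg.2 (hgθ a))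
    nlinarith

end Guessing

namespace Guessing

/-! ### Pasts and the one-step operator -/

section Pasts

variable {A : Type*}

/-- Append the symbol `a` to the past `w`. -/
def cons (a : A) (w : Pasts A) : Pasts A := fun i => if h : (i : ℤ) + 1 < 0 then w ⟨i + 1, h⟩ else a

/-- The `k`-th most recent symbol of a past. -/
def recent (w : Pasts A) (k : ℕ) : A := w ⟨-(k : ℤ) - 1, by omega⟩

@[simp] theorem recent_cons_zero (a : A) (w : Pasts A) : recent (cons a w) 0 = a := by
  simp [recent, cons]

@[simp] theorem recent_cons_succ (a : A) (w : Pasts A) (k : ℕ) :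
    recent (cons a w) (k + 1) = recent w k := by
  have h : -((k + 1 : ℕ) : ℤ) - 1 + 1 < 0 := by omega
  simp only [recent, cons, dif_pos h]
  congr 2; push_cast; ring

/-- The two pasts carry the same last `s` symbols. -/
def AgreeOn (s : ℕ) (w w' : Pasts A) : Prop :=
  ∀ i : {i : ℤ // i < 0}, -(s : ℤ) ≤ (i : ℤ) → w i = w' i

theorem agreeOn_zero (w w' : Pasts A) : AgreeOn 0 w w' := fun i h => by
  have := i.2; simp at h; omega

theorem AgreeOn.cons {s : ℕ} {w w' : Pasts A} (h : AgreeOn s w w') (a : A) :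
    AgreeOn (s + 1) (cons a w) (cons a w') := fun i hi => by
  simp only [Guessing.cons]
  split_ifs with h'
  · exact h _ (by push_cast at hi ⊢; linarith)
  · rfl

open Classical in
/-- Total charge of the disagreements of `w` and `w'`, `d (k + j)` for the `j`-th symbol. -/
noncomputable def mismatch (d : ℕ → ℝ) (n k : ℕ) (w w' : Pasts A) : ℝ :=
  ∑ j ∈ Finset.range n, if recent w j = recent w' j then 0 else d (k + j)

theorem mismatch_cons_eq (d : ℕ → ℝ) (n k : ℕ) (a a' : A) (w w' : Pasts A) [Decidable (a = a')] :
    mismatch d (n + 1) k (cons a w) (cons a' w') =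
      mismatch d n (k + 1) w w' + if a = a' then 0 else d k := by
  unfold mismatch
  rw [Finset.sum_range_succ']
  congr 1
  · refine Finset.sum_congr rfl fun j _ => ?_
    rw [recent_cons_succ, recent_cons_succ, show k + (j + 1) = k + 1 + j by omega]
  · simp only [recent_cons_zero, add_zero]

theorem mismatch_le_succ {d : ℕ → ℝ} (hd : ∀ j, 0 ≤ d j) (n k : ℕ) (w w' : Pasts A) :
    mismatch d n k w w' ≤ mismatch d (n + 1) k w w' :=
  Finset.sum_le_sum_of_subset_of_nonneg (Finset.range_mono (Nat.le_succ n))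
    fun j _ _ => by split_ifs <;> simp [hd]

theorem mismatch_cons_self_le {d : ℕ → ℝ} (hd : ∀ j, 0 ≤ d j) (n k : ℕ) (a : A) (w w' : Pasts A) :
    mismatch d n k (cons a w) (cons a w') ≤ mismatch d n (k + 1) w w' := by
  classical
  refine (mismatch_le_succ hd n k _ _).trans ?_
  simp [mismatch_cons_eq]

theorem mismatch_cons_le {d : ℕ → ℝ} (hd : ∀ j, 0 ≤ d j) (n k : ℕ) (a a' : A) (w w' : Pasts A) :
    mismatch d n k (cons a w) (cons a' w') ≤ d k + mismatch d n (k + 1) w w' := by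
  classical
  refine (mismatch_le_succ hd n k _ _).trans ?_
  rw [mismatch_cons_eq, add_comm]
  gcongr
  split_ifs <;> simp [hd]

theorem mismatch_self (d : ℕ → ℝ) (n k : ℕ) (w : Pasts A) : mismatch d n k w w = 0 := by
  simp [mismatch]

end Pasts

variable {A : Type*} [MeasurableSpace A]

theorem measurable_cons : Measurable fun z : Pasts A × A => cons z.2 z.1 := by
  refine measurable_pi_iff.2 fun i => ?_
  by_cases h : (i : ℤ) + 1 < 0
  · simp only [cons, h, dif_pos]
    exact (measurable_pi_apply (⟨i + 1, h⟩ : {i : ℤ // i < 0})).comp measurable_fst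
  · simpa [cons, h] using measurable_snd

theorem measurable_cons_left (w : Pasts A) : Measurable fun a : A => cons a w :=
  measurable_cons.comp measurable_prodMk_left

/-- Bounded measurable functions. -/
def IsBoundedMeasurable {Ω : Type*} [MeasurableSpace Ω] (h : Ω → ℝ) : Prop :=
  Measurable h ∧ ∃ M, ∀ w, |h w| ≤ M

theorem IsBoundedMeasurable.integrable {Ω : Type*} [MeasurableSpace Ω] {h : Ω → ℝ}
    (hh : IsBoundedMeasurable h) (μ : Measure Ω) [IsFiniteMeasure μ] : Integrable h μ := by
  obtain ⟨hm, M, hM⟩ := hh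
  exact Integrable.of_bound hm.aestronglyMeasurable M (ae_of_all _ (by simpa using hM))

theorem IsBoundedMeasurable.comp {Ω Ω' : Type*} [MeasurableSpace Ω] [MeasurableSpace Ω']
    {h : Ω → ℝ} (hh : IsBoundedMeasurable h) {g : Ω' → Ω} (hg : Measurable g) :
    IsBoundedMeasurable fun w => h (g w) :=
  ⟨hh.1.comp hg, hh.2.imp fun _ hM _ => hM _⟩

theorem IsBoundedMeasurable.exp_mul {Ω : Type*} [MeasurableSpace Ω] {h : Ω → ℝ}
    (hh : IsBoundedMeasurable h) (t : ℝ) : IsBoundedMeasurable fun w => Real.exp (t * h w) := by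
  obtain ⟨hm, M, hM⟩ := hh
  refine ⟨(hm.const_mul t).exp, Real.exp (|t| * M), fun w => ?_⟩
  rw [Real.abs_exp]
  refine Real.exp_le_exp.2 ((le_abs_self _).trans ?_)
  rw [abs_mul]
  exact mul_le_mul_of_nonneg_left (hM w) (abs_nonneg t)

/-- The expectation of `h` after one step of the chain. -/
noncomputable def stepOp (p : Kernel (Pasts A) A) (h : Pasts A → ℝ) (w : Pasts A) : ℝ :=
  ∫ a, h (cons a w) ∂p w

variable {p : Kernel (Pasts A) A} [IsMarkovKernel p]

theorem IsBoundedMeasurable.stepOp {h : Pasts A → ℝ} (hh : IsBoundedMeasurable h) :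
    IsBoundedMeasurable (stepOp p h) := by
  obtain ⟨hm, M, hM⟩ := hh
  refine ⟨?_, M, fun w => ?_⟩
  · exact (StronglyMeasurable.integral_kernel_prod_right' (κ := p)
      (hm.comp measurable_cons).stronglyMeasurable).measurable
  · have := norm_integral_le_of_norm_le_const (μ := p w) (f := fun a => h (cons a w)) (C := M)
      (ae_of_all _ fun a => by simpa using hM _)
    simpa [Guessing.stepOp] using this

theorem IsBoundedMeasurable.iterate_stepOp {h : Pasts A → ℝ} (hh : IsBoundedMeasurable h) (k : ℕ) :
    IsBoundedMeasurable ((Guessing.stepOp p)^[k] h) := by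
  induction k with
  | zero => exact hh
  | succ k ih => rw [Function.iterate_succ_apply']; exact ih.stepOp

/-! ### The variation -/

theorem variation_nonneg {A : Type*} [MeasurableSpace A] {p : Kernel (Pasts A) A} (s : ℕ) :
    0 ≤ variation p s := by
  refine Real.sSup_nonneg ?_
  rintro _ ⟨x, y, -, rfl⟩
  exact mul_nonneg (by norm_num) (tsum_nonneg fun _ => abs_nonneg _)

section Variation

variable [Countable A] [DiscreteMeasurableSpace A]

theorem tv_le_one (μ ν : Measure A) [IsProbabilityMeasure μ] [IsProbabilityMeasure ν] :
    (1 / 2 : ℝ) * ∑' a : A, |μ.real {a} - ν.real {a}| ≤ 1 := by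
  have hμ := hasSum_real_singleton μ
  have hν := hasSum_real_singleton ν
  have h := hasSum_le (fun a => ?_) (hμ.summable.sub hν.summable).abs.hasSum (hμ.add hν)
  · linarith
  · have h1 : 0 ≤ μ.real {a} := measureReal_nonneg
    have h2 : 0 ≤ ν.real {a} := measureReal_nonneg
    exact abs_le.2 ⟨by linarith, by linarith⟩

theorem tv_le_variation {s : ℕ} {w w' : Pasts A} (h : AgreeOn s w w') :
    (1 / 2 : ℝ) * ∑' a : A, |(p w).real {a} - (p w').real {a}| ≤ variation p s := by
  refine le_csSup ⟨1, ?_⟩ ⟨w, w', h, rfl⟩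
  rintro _ ⟨x, y, -, rfl⟩
  exact tv_le_one _ _

theorem variation_le_one (s : ℕ) : variation p s ≤ 1 := by
  refine Real.sSup_le ?_ zero_le_one
  rintro _ ⟨x, y, -, rfl⟩
  exact tv_le_one _ _

theorem variation_antitone : Antitone (variation p) := by
  intro s t hst
  refine Real.sSup_le ?_ (variation_nonneg s)
  rintro _ ⟨x, y, h, rfl⟩
  exact tv_le_variation fun i hi => h i (by omega)

theorem gammaConst_le_prod (s : Finset ℕ) : gammaConst p ≤ ∏ j ∈ s, (1 - variation p j) := by
  have h0 : ∀ j, 0 ≤ 1 - variation p j := fun j => sub_nonneg.2 (variation_le_one j)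
  have h1 : ∀ j, 1 - variation p j ≤ 1 := fun j => by linarith [variation_nonneg (p := p) j]
  have anti : Antitone fun s : Finset ℕ => ∏ j ∈ s, (1 - variation p j) := fun s t hst =>
    Finset.prod_le_prod_of_subset_of_le_one hst (fun i _ => h0 i) fun i _ _ => h1 i
  have hb : BddBelow (Set.range fun s : Finset ℕ => ∏ j ∈ s, (1 - variation p j)) :=
    ⟨0, by rintro _ ⟨s, rfl⟩; exact Finset.prod_nonneg fun j _ => h0 j⟩
  -- `tprod` would default to 1 without convergence; here the finite products decrease with the
  -- index set, so they converge to their infimum.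
  have hp : HasProd (fun j => 1 - variation p j) (⨅ s : Finset ℕ, ∏ j ∈ s, (1 - variation p j)) := by
    simpa [HasProd] using tendsto_atTop_ciInf anti hb
  rw [gammaConst, hp.tprod_eq]
  exact ciInf_le hb s

theorem gammaConst_le_one : gammaConst p ≤ 1 := by simpa using gammaConst_le_prod (p := p) ∅

/-- One step of a maximal coupling: equal symbols lengthen the agreement to `s + 1`, while unequal
ones reset it to 0 and cost `d k`. The recursion is that of `couplingBound_succ`. Old disagreements
persist and are merely shifted further into the past, which is the term `mismatch d n k`. -/
theorem iterate_stepOp_sub_le {F : Pasts A → ℝ} (hF : IsBoundedMeasurable F) {d : ℕ → ℝ}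
    (hd : ∀ j, 0 ≤ d j) {n : ℕ} (hlip : ∀ w w', F w - F w' ≤ mismatch d n 0 w w') (k : ℕ) :
    ∀ s w w', AgreeOn s w w' → (stepOp p)^[k] F w - (stepOp p)^[k] F w' ≤
      couplingBound (variation p) d k s + mismatch d n k w w' := by
  induction k with
  | zero => intro s w w' _; simpa [couplingBound] using hlip w w'
  | succ k ih =>
    intro s w w' h
    rw [Function.iterate_succ_apply']
    obtain ⟨-, M, hM⟩ := hF.iterate_stepOp (p := p) k
    have := integral_sub_integral_le_of_coupling (p w) (p w') (M := M)
      (f := fun a => (stepOp p)^[k] F (cons a w)) (g := fun a => (stepOp p)^[k] F (cons a w'))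
      (x := couplingBound (variation p) d k (s + 1) + mismatch d n (k + 1) w w')
      (c := couplingBound (variation p) d k 0 + d k + mismatch d n (k + 1) w w')
      (fun _ => hM _) (fun _ => hM _)
      (fun a => (ih _ _ _ (h.cons a)).trans
        (by linarith [mismatch_cons_self_le hd n k a w w']))
      (fun a a' => (ih 0 _ _ (agreeOn_zero _ _)).trans
        (by linarith [mismatch_cons_le hd n k a a' w w']))
      (by
        have := couplingBound_le_zero (variation_le_one (p := p)) variation_antitone hd k (s + 1)
        linarith [hd k])
      (tv_le_variation h)
    rw [couplingBound_succ]
    unfold stepOp at this ⊢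
    linarith

/-- Oscillation of the `k`-step expectation caused by the choice of one symbol. -/
noncomputable def oscBound (p : Kernel (Pasts A) A) (d : ℕ → ℝ) (k : ℕ) : ℝ :=
  couplingBound (variation p) d k 0 + d k

theorem oscBound_nonneg {d : ℕ → ℝ} (hd : ∀ j, 0 ≤ d j) (k : ℕ) : 0 ≤ oscBound p d k :=
  add_nonneg (Finset.sum_nonneg fun _ _ =>
    mul_nonneg (houseProb_nonneg variation_nonneg variation_le_one _ _) (hd _)) (hd k)

/-- Young's inequality, with the expected number of visits to 0 as the `ℓ¹` norm. -/
theorem sum_sq_oscBound_le (hΓ : 0 < gammaConst p) {d : ℕ → ℝ} {S : ℝ}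
    (hS : ∀ N, ∑ j ∈ Finset.range N, d j ^ 2 ≤ S) (N : ℕ) :
    ∑ k ∈ Finset.range N, oscBound p d k ^ 2 ≤ S / gammaConst p ^ 2 := by
  have h := sum_sq_convolution_le (u := fun l => houseProb (variation p) l 0) (v := d)
    (U := 1 / gammaConst p) (W := S)
    (fun l => houseProb_nonneg variation_nonneg variation_le_one l 0)
    (fun N => by
      rw [le_div_iff₀ hΓ, mul_comm]
      exact mul_sum_houseProb_le hΓ variation_nonneg variation_le_one
        (fun s => gammaConst_le_prod _) N) hS N
  simp only [oscBound, couplingBound_zero_add]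
  refine h.trans (le_of_eq ?_)
  rw [div_pow, one_pow, one_div, mul_comm, div_eq_mul_inv]

end Variation

end Guessing

namespace Guessing

/-! ### Exponential moments -/

section ExponentialMoments

variable {A : Type*} [MeasurableSpace A] {p : Kernel (Pasts A) A} [IsMarkovKernel p]

/-- Hoeffding's lemma under `p w`: given the past, the next symbol moves `h` within an interval of
length `d`. -/
theorem stepOp_exp_le {h : Pasts A → ℝ} (hh : IsBoundedMeasurable h) {w : Pasts A} {d : ℝ}
    (hd : ∀ a a', h (cons a w) - h (cons a' w) ≤ d) (t : ℝ) :
    stepOp p (fun w => Real.exp (t * h w)) w ≤ Real.exp (t * stepOp p h w + t ^ 2 * d ^ 2 / 8) := by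
  obtain ⟨hm, M, hM⟩ := hh
  have hne : Nonempty A := (p w).nonempty_of_neZero
  have hd0 : 0 ≤ d := by simpa using hd hne.some hne.some
  have hb : BddBelow (Set.range fun a => h (cons a w)) :=
    ⟨-M, by rintro _ ⟨a, rfl⟩; exact (abs_le.1 (hM _)).1⟩
  set lo := ⨅ a, h (cons a w) with hlo
  have hX : ∀ a, h (cons a w) ∈ Set.Icc lo (lo + d) := fun a =>
    ⟨ciInf_le hb a, by
      have : h (cons a w) - d ≤ lo := le_ciInf fun a' => by linarith [hd a a']
      linarith⟩
  have hs := (hasSubgaussianMGF_of_mem_Icc (μ := p w)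
    (hm.comp (measurable_cons_left w)).aemeasurable (ae_of_all _ hX)).mgf_le t
  simp only [mgf, Function.comp_apply] at hs
  simp only [mul_sub] at hs
  simp only [sub_eq_add_neg, Real.exp_add] at hs
  rw [integral_mul_const] at hs
  have hpos := Real.exp_pos (t * stepOp p h w)
  have e : Real.exp (-(t * ∫ x, h (cons x w) ∂p w)) = (Real.exp (t * stepOp p h w))⁻¹ := by
    rw [Real.exp_neg]; rfl
  rw [e, ← div_eq_mul_inv, div_le_iff₀ hpos] at hs
  rw [Real.exp_add]
  refine hs.trans (le_of_eq ?_)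
  rw [mul_comm]
  congr 2
  simp [abs_of_nonneg hd0]
  ring

/-- The Azuma–Hoeffding argument in operator form: each application of `stepOp` integrates out one
symbol and costs one factor from `stepOp_exp_le`. -/
theorem iterate_stepOp_exp_le {F : Pasts A → ℝ} (hF : IsBoundedMeasurable F) {T : ℕ → ℝ}
    (hT : ∀ k w a a', (stepOp p)^[k] F (cons a w) - (stepOp p)^[k] F (cons a' w) ≤ T k)
    (t : ℝ) (k : ℕ) : ∀ w, (stepOp p)^[k] (fun w => Real.exp (t * F w)) w ≤
      Real.exp (t * (stepOp p)^[k] F w + t ^ 2 * (∑ j ∈ Finset.range k, T j ^ 2) / 8) := by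
  induction k with
  | zero => intro w; simp
  | succ k ih =>
    intro w
    have hk := hF.iterate_stepOp (p := p) k
    simp only [Function.iterate_succ_apply']
    have hint := (hk.exp_mul t).comp (measurable_cons_left w)
    calc _ ≤ stepOp p (fun w => Real.exp (t * (stepOp p)^[k] F w) *
            Real.exp (t ^ 2 * (∑ j ∈ Finset.range k, T j ^ 2) / 8)) w := by
          refine integral_mono ?_ ?_ fun a => ?_
          · exact (((hF.exp_mul t).iterate_stepOp k).comp (measurable_cons_left w)).integrable _
          · exact (hint.integrable _).mul_const _
          · dsimp only
            rw [← Real.exp_add]; exact ih _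
      _ = stepOp p (fun w => Real.exp (t * (stepOp p)^[k] F w)) w *
            Real.exp (t ^ 2 * (∑ j ∈ Finset.range k, T j ^ 2) / 8) := by
          unfold stepOp; exact integral_mul_const _ _
      _ ≤ _ := by
          refine (mul_le_mul_of_nonneg_right (stepOp_exp_le hk (hT k w) t)
            (Real.exp_pos _).le).trans (le_of_eq ?_)
          rw [← Real.exp_add, Finset.sum_range_succ]
          congr 1; ring

end ExponentialMoments

/-! ### The invariant law of the past -/

section Invariance

variable {A : Type*} [MeasurableSpace A]

theorem measurable_leftPast : Measurable (leftPast (A := A)) :=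
  measurable_pi_iff.2 fun i => measurable_pi_apply (i : ℤ)

end Invariance

theorem integral_comp_of_isStationary {A : Type*} [MeasurableSpace A] {P : Measure (ℤ → A)}
    (hP : IsStationary P) {g : (ℤ → A) → ℝ} (hg : Measurable g) :
    ∫ x, g (fun k => x (k + 1)) ∂P = ∫ x, g x ∂P := by
  have hP' : MeasurePreserving (fun (x : ℤ → A) (k : ℤ) => x (k + 1)) P P := hP
  rw [← integral_map hP'.measurable.aemeasurable hg.aestronglyMeasurable, hP'.map_eq]

theorem integral_comp_add_of_isStationary {A : Type*} [MeasurableSpace A] {P : Measure (ℤ → A)}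
    (hP : IsStationary P) {g : (ℤ → A) → ℝ} (hg : Measurable g) (i : ℕ) :
    ∫ x, g (fun k => x (k + i)) ∂P = ∫ x, g x ∂P := by
  induction i with
  | zero => simp
  | succ i ih =>
    have hm : Measurable fun x : ℤ → A => g fun k => x (k + i) :=
      hg.comp (measurable_pi_iff.2 fun k => measurable_pi_apply _)
    rw [← ih, ← integral_comp_of_isStationary hP hm]
    simp only [Nat.cast_succ, add_assoc]

variable {A : Type*} [Countable A] [MeasurableSpace A] [DiscreteMeasurableSpace A]
variable {P : Measure (ℤ → A)} [IsProbabilityMeasure P] {p : Kernel (Pasts A) A} [IsMarkovKernel p]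

/-- The hypothesis on `p` concerns one symbol at a time, which settles the rectangles `S ×ˢ {a}`;
countability of `A` gives all rectangles. -/
theorem map_leftPast_prod (hp : IsLeftCondProb P p) :
    P.map (fun x => (leftPast x, x 0)) = (P.map leftPast).compProd p := by
  have hL := measurable_leftPast (A := A)
  have h0 : Measurable fun x : ℤ → A => x 0 := measurable_pi_apply 0
  have : IsProbabilityMeasure (P.map (leftPast (A := A))) :=
    Measure.isProbabilityMeasure_map hL.aemeasurable
  have hpair := hL.prodMk h0
  have : IsProbabilityMeasure (P.map (fun x : ℤ → A => (leftPast x, x 0))) :=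
    Measure.isProbabilityMeasure_map hpair.aemeasurable
  have key : ∀ (S : Set (Pasts A)), MeasurableSet S → ∀ a : A,
      P.map (fun x => (leftPast x, x 0)) (S ×ˢ {a}) = ((P.map leftPast).compProd p) (S ×ˢ {a}) := by
    intro S hS a
    rw [Measure.map_apply hpair (hS.prod (measurableSet_singleton a)),
      Measure.compProd_apply_prod hS (measurableSet_singleton a), setLIntegral_map hS
        (p.measurable_coe (measurableSet_singleton a)) hL]
    have hle : MeasurableSpace.comap (leftPast (A := A)) MeasurableSpace.pi ≤ MeasurableSpace.pi :=
      hL.comap_le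
    have hE : MeasurableSet {x : ℤ → A | x 0 = a} := h0 (measurableSet_singleton a)
    have hi : Integrable (Set.indicator {x : ℤ → A | x 0 = a} (fun _ => (1 : ℝ))) P :=
      (integrable_const 1).indicator hE
    have e := setIntegral_condExp hle hi (s := leftPast ⁻¹' S) ⟨S, hS, rfl⟩
    rw [setIntegral_congr_ae (hL hS) ((hp a).mono fun x hx _ => hx),
      setIntegral_indicator hE] at e
    simp only [integral_const, smul_eq_mul, mul_one, measureReal_restrict_apply_univ] at e
    have hfin : ∫⁻ x in leftPast ⁻¹' S, (p (leftPast x)) {a} ∂P ≠ ⊤ := by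
      refine ne_of_lt (lt_of_le_of_lt (lintegral_mono fun x => prob_le_one) ?_)
      simp
    have e2 : ∫ x in leftPast ⁻¹' S, ((p (leftPast x)).real {a}) ∂P =
        (∫⁻ x in leftPast ⁻¹' S, (p (leftPast x)) {a} ∂P).toReal :=
      integral_toReal ((p.measurable_coe (measurableSet_singleton a)).comp hL).aemeasurable
        (ae_of_all _ fun x => measure_lt_top _ _)
    rw [e2] at e
    have e3 : (fun x : ℤ → A => (leftPast x, x 0)) ⁻¹' S ×ˢ {a} =
        leftPast ⁻¹' S ∩ {x | x 0 = a} := by ext; simp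
    rw [e3]
    exact ((ENNReal.toReal_eq_toReal_iff' hfin (measure_ne_top _ _)).1 e).symm
  refine Measure.ext_prod fun {S} {T} hS hT => ?_
  have hT' : S ×ˢ T = ⋃ a : T, S ×ˢ {(a : A)} := by ext ⟨x, y⟩; simp
  rw [hT', measure_iUnion, measure_iUnion]
  · exact tsum_congr fun a => key S hS a
  all_goals first
    | exact fun a => hS.prod (measurableSet_singleton _)
    | (intro a b hab
       refine Set.disjoint_left.2 ?_
       rintro ⟨x, y⟩ h1 h2
       simp at h1 h2
       exact hab (Subtype.ext (h1.2.symm.trans h2.2)))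

/-- Drawing a symbol from `p` and appending it produces the past of the shifted process, whose law
is the same by stationarity. -/
theorem integral_stepOp (hP : IsStationary P) (hp : IsLeftCondProb P p) {h : Pasts A → ℝ}
    (hh : IsBoundedMeasurable h) :
    ∫ w, stepOp p h w ∂(P.map leftPast) = ∫ w, h w ∂(P.map leftPast) := by
  have hL := measurable_leftPast (A := A)
  have h0 : Measurable fun x : ℤ → A => x 0 := measurable_pi_apply 0
  have : IsProbabilityMeasure (P.map (leftPast (A := A))) :=
    Measure.isProbabilityMeasure_map hL.aemeasurable
  have hc := hh.comp (measurable_cons (A := A))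
  calc ∫ w, stepOp p h w ∂(P.map leftPast)
      = ∫ z, h (cons z.2 z.1) ∂((P.map leftPast).compProd p) :=
        (Measure.integral_compProd (hc.integrable _)).symm
    _ = ∫ x, h (cons (x 0) (leftPast x)) ∂P := by
        rw [← map_leftPast_prod hp, integral_map (hL.prodMk h0).aemeasurable
          hc.1.aestronglyMeasurable]
    _ = ∫ x, h (leftPast (fun k => x (k + 1))) ∂P := by
        congr 1; funext x; congr 1; funext i
        simp only [cons, leftPast]
        split_ifs with hi
        · rfl
        · rw [show (i : ℤ) + 1 = 0 by have := i.2; omega]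
    _ = ∫ x, h (leftPast x) ∂P := integral_comp_of_isStationary hP (hh.comp hL).1
    _ = _ := (integral_map hL.aemeasurable hh.1.aestronglyMeasurable).symm

theorem integral_iterate_stepOp (hP : IsStationary P) (hp : IsLeftCondProb P p) {h : Pasts A → ℝ}
    (hh : IsBoundedMeasurable h) (k : ℕ) :
    ∫ w, (stepOp p)^[k] h w ∂(P.map leftPast) = ∫ w, h w ∂(P.map leftPast) := by
  induction k with
  | zero => rfl
  | succ k ih =>
    simp only [Function.iterate_succ_apply']
    rw [integral_stepOp hP hp (hh.iterate_stepOp k), ih]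

/-- Gaussian concentration for functions of the past with summable oscillations. -/
theorem integral_exp_le (hP : IsStationary P) (hp : IsLeftCondProb P p) (hΓ : 0 < gammaConst p)
    {F : Pasts A → ℝ} (hF : IsBoundedMeasurable F) {d : ℕ → ℝ} (hd : ∀ j, 0 ≤ d j) {n : ℕ}
    (hdn : ∀ j, n ≤ j → d j = 0)
    (hlip : ∀ w w', F w - F w' ≤ mismatch d n 0 w w') {S : ℝ}
    (hS : ∀ N, ∑ j ∈ Finset.range N, d j ^ 2 ≤ S) (t : ℝ) :
    ∫ w, Real.exp (t * (F w - ∫ v, F v ∂(P.map leftPast))) ∂(P.map leftPast) ≤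
      Real.exp (S / gammaConst p ^ 2 / 4 * t ^ 2 / 2) := by
  set μ := P.map (leftPast (A := A)) with hμ
  have : IsProbabilityMeasure μ :=
    Measure.isProbabilityMeasure_map (measurable_leftPast (A := A)).aemeasurable
  set m := ∫ v, F v ∂μ with hm
  set T := oscBound p d with hTdef
  set B := S / gammaConst p ^ 2 with hB
  have hTB : ∀ N, ∑ k ∈ Finset.range N, T k ^ 2 ≤ B := sum_sq_oscBound_le hΓ hS
  have hT0 : Filter.Tendsto T Filter.atTop (nhds 0) := by
    have hs : Summable fun k => T k ^ 2 := summable_of_sum_range_le (fun k => sq_nonneg _) hTB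
    have h2 := hs.tendsto_atTop_zero.sqrt
    simpa [Real.sqrt_sq (oscBound_nonneg hd _), hTdef] using h2
  have hT : ∀ k w a a', (stepOp p)^[k] F (cons a w) - (stepOp p)^[k] F (cons a' w) ≤ T k := by
    intro k w a a'
    refine (iterate_stepOp_sub_le hF hd hlip k 0 _ _ (agreeOn_zero _ _)).trans ?_
    rw [hTdef, oscBound]
    have := mismatch_cons_le hd n k a a' w w
    rw [mismatch_self] at this
    linarith
  -- After `n` steps the initial past lies beyond every charged coordinate, so `T k` bounds the
  -- difference between any two initial pasts. Averaging one of them over the invariant law replaces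
  -- its value by `m`.
  have hfar : ∀ k, n ≤ k → ∀ w, (stepOp p)^[k] F w - m ≤ T k ∧ m - (stepOp p)^[k] F w ≤ T k := by
    intro k hk w
    have h1 : ∀ w w', (stepOp p)^[k] F w - (stepOp p)^[k] F w' ≤ T k := fun w w' => by
      refine (iterate_stepOp_sub_le hF hd hlip k 0 _ _ (agreeOn_zero _ _)).trans ?_
      have : mismatch d n k w w' = 0 := Finset.sum_eq_zero fun j _ => by
        simp [hdn (k + j) (by omega)]
      rw [this, hTdef, oscBound]
      linarith [hd k]
    have hk' := (hF.iterate_stepOp (p := p) k).integrable μ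
    have e : ∫ v, (stepOp p)^[k] F v ∂μ = m := integral_iterate_stepOp hP hp hF k
    constructor
    · have := integral_mono (integrable_const ((stepOp p)^[k] F w - T k)) hk' fun v => by
        dsimp only; linarith [h1 w v]
      rw [e] at this; simp at this; linarith
    · have := integral_mono hk' (integrable_const ((stepOp p)^[k] F w + T k)) fun v => by
        dsimp only; linarith [h1 v w]
      rw [e] at this; simp at this; linarith
  have hN : ∀ k, n ≤ k → ∫ w, Real.exp (t * (F w - m)) ∂μ ≤
      Real.exp (|t| * T k + t ^ 2 * B / 8) := by
    intro k hk
    have e : ∫ w, Real.exp (t * (F w - m)) ∂μ =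
        (∫ w, (stepOp p)^[k] (fun w => Real.exp (t * F w)) w ∂μ) * Real.exp (-(t * m)) := by
      rw [integral_iterate_stepOp hP hp (hF.exp_mul t), ← integral_mul_const]
      congr 1; funext w; rw [← Real.exp_add]; congr 1; ring
    rw [e, ← integral_mul_const]
    have hi := (((hF.exp_mul t).iterate_stepOp (p := p) k).integrable μ).mul_const
      (Real.exp (-(t * m)))
    refine (integral_mono hi (integrable_const _) fun w => ?_).trans_eq
      (show ∫ _, Real.exp (|t| * T k + t ^ 2 * B / 8) ∂μ = _ by simp)
    dsimp only
    refine (mul_le_mul_of_nonneg_right (iterate_stepOp_exp_le hF hT t k w)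
      (Real.exp_pos _).le).trans ?_
    rw [← Real.exp_add]
    refine Real.exp_le_exp.2 ?_
    have h1 : t * ((stepOp p)^[k] F w - m) ≤ |t| * T k := by
      refine (le_abs_self _).trans ?_
      rw [abs_mul]
      exact mul_le_mul_of_nonneg_left
        (abs_le.2 ⟨by linarith [(hfar k hk w).2], (hfar k hk w).1⟩) (abs_nonneg t)
    have h2 := mul_le_mul_of_nonneg_left (hTB k) (sq_nonneg t)
    linarith
  -- The left side of `hN` does not depend on `k`, so letting `k` tend to infinity removes the
  -- influence of the initial past.
  have hlim : Filter.Tendsto (fun k => Real.exp (|t| * T k + t ^ 2 * B / 8)) Filter.atTop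
      (nhds (Real.exp (|t| * 0 + t ^ 2 * B / 8))) :=
    (Real.continuous_exp.tendsto _).comp ((hT0.const_mul _).add_const _)
  refine (ge_of_tendsto hlim (Filter.eventually_atTop.2 ⟨n, hN⟩)).trans (le_of_eq ?_)
  congr 1; ring

/-- The variance of a sub-Gaussian variable is at most its parameter. -/
theorem integral_sq_le_of_hasSubgaussianMGF {Ω : Type*} [MeasurableSpace Ω] {μ : Measure Ω}
    [IsProbabilityMeasure μ] {X : Ω → ℝ} {c : NNReal} (h : HasSubgaussianMGF X c μ) :
    ∫ ω, X ω ^ 2 ∂μ ≤ c := by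
  -- Averaging the bounds at `t` and `-t` turns exponentials into `cosh`, which dominates `1 + z ^ 2
  -- / 2`; with `exp u - 1 ≤ u * exp u` this gives `key`, and `t → 0` removes the last factor.
  have hcosh : ∀ z : ℝ, 1 + z ^ 2 / 2 ≤ (Real.exp z + Real.exp (-z)) / 2 := fun z => by
    have h1 : z / 2 * (z / 2) ≤ Real.sinh (z / 2) ^ 2 := by
      rw [← sq, ← sq_abs (z / 2), ← sq_abs (Real.sinh _), Real.abs_sinh]
      exact pow_le_pow_left₀ (abs_nonneg _) (Real.self_le_sinh_iff.2 (abs_nonneg _)) 2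
    have h2 := Real.cosh_two_mul (z / 2)
    rw [Real.cosh_sq, mul_div_cancel₀ z two_ne_zero] at h2
    rw [← Real.cosh_eq, h2]
    linarith
  have hsq : Integrable (fun ω => X ω ^ 2) μ := (h.memLp 2).integrable_sq
  have key : ∀ t : ℝ, 0 < t → ∫ ω, X ω ^ 2 ∂μ ≤ c * Real.exp (c * t ^ 2 / 2) := by
    intro t ht
    have h1 := h.mgf_le t
    have h2 := h.mgf_le (-t)
    have h3 : ∫ ω, (1 + (t * X ω) ^ 2 / 2) ∂μ ≤
        ∫ ω, (Real.exp (t * X ω) + Real.exp (-t * X ω)) / 2 ∂μ := by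
      refine integral_mono ?_ ?_ fun ω => ?_
      · simp only [mul_pow, mul_div_right_comm _ _ (2 : ℝ)]
        exact (integrable_const 1).add (hsq.const_mul _)
      · exact ((h.integrable_exp_mul t).add (h.integrable_exp_mul (-t))).div_const 2
      · simpa using hcosh (t * X ω)
    have e1 : ∫ ω, (1 + (t * X ω) ^ 2 / 2) ∂μ = 1 + t ^ 2 / 2 * ∫ ω, X ω ^ 2 ∂μ := by
      simp only [mul_pow, mul_div_right_comm _ _ (2 : ℝ)]
      rw [integral_add (integrable_const 1) (hsq.const_mul _), integral_const_mul]
      simp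
    have e2 : ∫ ω, (Real.exp (t * X ω) + Real.exp (-t * X ω)) / 2 ∂μ = (mgf X μ t + mgf X μ (-t)) / 2 := by
      rw [integral_div, integral_add (h.integrable_exp_mul t) (h.integrable_exp_mul (-t))]
      rfl
    rw [neg_sq] at h2
    have h4 : 1 - (c * t ^ 2 / 2) ≤ Real.exp (-(c * t ^ 2 / 2)) := by
      linarith [Real.add_one_le_exp (-(c * t ^ 2 / 2 : ℝ))]
    have h5 := mul_le_mul_of_nonneg_right h4 (Real.exp_pos (c * t ^ 2 / 2)).le
    rw [← Real.exp_add, neg_add_cancel, Real.exp_zero] at h5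
    have ht2 : 0 < t ^ 2 / 2 := by positivity
    refine le_of_mul_le_mul_left ?_ ht2
    nlinarith
  have hlim : Filter.Tendsto (fun t : ℝ => c * Real.exp (c * t ^ 2 / 2)) (nhdsWithin 0 (Set.Ioi 0))
      (nhds (c * Real.exp (c * 0 ^ 2 / 2))) :=
    (Continuous.tendsto (by fun_prop) 0).mono_left nhdsWithin_le_nhds
  simpa using ge_of_tendsto hlim (Filter.mem_of_superset self_mem_nhdsWithin key)

/-! ### Functions of a sample -/

/-- The sample formed by the last `n` symbols of a past. -/
def sampleOfPast {A : Type*} (n : ℕ) (w : Pasts A) : Sample A n := fun j =>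
  w ⟨(j : ℤ) - n - 1, by have := Finset.mem_Icc.1 j.2; omega⟩

theorem measurable_sampleOfPast {A : Type*} [MeasurableSpace A] (n : ℕ) :
    Measurable (sampleOfPast (A := A) n) :=
  measurable_pi_iff.2 fun _ => measurable_pi_apply _

theorem measurable_sample {A : Type*} [MeasurableSpace A] (n : ℕ) :
    Measurable (sample (A := A) n) :=
  measurable_pi_iff.2 fun _ => measurable_pi_apply _

theorem integral_sampleOfPast {A : Type*} [MeasurableSpace A] {P : Measure (ℤ → A)}
    (hP : IsStationary P) {n : ℕ} {Φ : Sample A n → ℝ} (hΦ : Measurable Φ) :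
    ∫ w, Φ (sampleOfPast n w) ∂(P.map leftPast) = ∫ x, Φ (sample n x) ∂P := by
  have hm := hΦ.comp (measurable_sampleOfPast (A := A) n)
  have hL := measurable_leftPast (A := A)
  calc _ = ∫ x, Φ (sampleOfPast n (leftPast x)) ∂P :=
        integral_map hL.aemeasurable hm.aestronglyMeasurable
    _ = ∫ x, Φ (sampleOfPast n (leftPast fun k => x (k + (n + 1 : ℕ)))) ∂P :=
        (integral_comp_add_of_isStationary hP (hm.comp hL) (n + 1)).symm
    _ = _ := by
        congr 1; funext x; congr 1; funext j
        simp only [sampleOfPast, leftPast, sample, Finset.restrict]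
        congr 1; push_cast; ring

open Classical in
/-- Gaussian concentration for functions of a sample with bounded differences. -/
theorem hasSubgaussianMGF_sample (hP : IsStationary P) (hp : IsLeftCondProb P p)
    (hΓ : 0 < gammaConst p) {n : ℕ} {Φ : Sample A n → ℝ} {M : ℝ} (hM : ∀ s, |Φ s| ≤ M)
    {δ : ℤ → ℝ} (hδ : ∀ j, 0 ≤ δ j)
    (hlip : ∀ s s' : Sample A n, Φ s - Φ s' ≤
      ∑ j : Finset.Icc (1 : ℤ) (n : ℤ), if s j = s' j then 0 else δ j)
    {S : ℝ} (hS : ∑ j ∈ Finset.Icc (1 : ℤ) (n : ℤ), δ j ^ 2 ≤ S) :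
    HasSubgaussianMGF (fun x => Φ (sample n x) - ∫ y, Φ (sample n y) ∂P)
      (S / gammaConst p ^ 2 / 4).toNNReal P := by
  have hΦ : Measurable Φ := measurable_of_countable Φ
  have hB : IsBoundedMeasurable Φ := ⟨hΦ, M, hM⟩
  have hS0 : 0 ≤ S := (Finset.sum_nonneg fun j _ => sq_nonneg (δ j)).trans hS
  set m := ∫ y, Φ (sample n y) ∂P with hm
  -- Time is reversed: the most recent symbol, with index 0, is the sample coordinate `n`.
  set d : ℕ → ℝ := fun k => if k < n then δ (n - k) else 0 with hd
  have reindex : ∀ g : ℤ → ℝ, ∑ k ∈ Finset.range n, g (n - k) = ∑ j ∈ Finset.Icc (1 : ℤ) n, g j := by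
    intro g
    refine Finset.sum_nbij' (fun k => (n : ℤ) - k) (fun j => (n - j).toNat) ?_ ?_ ?_ ?_ ?_
    all_goals intro a ha; simp only [Finset.mem_range, Finset.mem_Icc] at *
    all_goals omega
  have hF : IsBoundedMeasurable fun w => Φ (sampleOfPast n w) :=
    hB.comp (measurable_sampleOfPast n)
  have hFlip : ∀ w w' : Pasts A, Φ (sampleOfPast n w) - Φ (sampleOfPast n w') ≤
      mismatch d n 0 w w' := by
    intro w w'
    refine (hlip _ _).trans (le_of_eq ?_)
    set g : ℤ → ℝ := fun j => if h : j - n - 1 < 0 then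
      (if w ⟨j - n - 1, h⟩ = w' ⟨j - n - 1, h⟩ then 0 else δ j) else 0 with hg
    have e1 : ∑ j : Finset.Icc (1 : ℤ) (n : ℤ),
        (if sampleOfPast n w j = sampleOfPast n w' j then 0 else δ j) =
        ∑ j ∈ Finset.Icc (1 : ℤ) n, g j := by
      rw [← Finset.sum_coe_sort _ g]
      refine Finset.sum_congr rfl fun j _ => ?_
      have hj : (j : ℤ) - n - 1 < 0 := by have := Finset.mem_Icc.1 j.2; omega
      simp only [hg, dif_pos hj]; rfl
    rw [e1, ← reindex, mismatch]
    refine Finset.sum_congr rfl fun k hk => ?_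
    have hk' : (n : ℤ) - k - n - 1 < 0 := by omega
    have e2 : (⟨(n : ℤ) - k - n - 1, hk'⟩ : {i : ℤ // i < 0}) = ⟨-(k : ℤ) - 1, by omega⟩ :=
      Subtype.ext (by ring)
    simp only [hg, dif_pos hk', e2, recent, hd, zero_add, if_pos (Finset.mem_range.1 hk)]
  have hSd : ∀ N, ∑ j ∈ Finset.range N, d j ^ 2 ≤ S := by
    intro N
    refine le_trans ?_ ((reindex fun j => δ j ^ 2).trans_le hS)
    calc ∑ j ∈ Finset.range N, d j ^ 2 ≤ ∑ j ∈ Finset.range (max N n), d j ^ 2 :=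
          Finset.sum_le_sum_of_subset_of_nonneg (Finset.range_mono (le_max_left _ _))
            fun _ _ _ => sq_nonneg _
      _ = ∑ j ∈ Finset.range n, d j ^ 2 := by
          refine (Finset.sum_subset (Finset.range_mono (le_max_right _ _)) fun j _ hj => ?_).symm
          have : ¬ j < n := by simpa using hj
          simp [hd, this]
      _ = _ := Finset.sum_congr rfl fun j hj => by simp [hd, Finset.mem_range.1 hj]
  refine ⟨fun t => ?_, fun t => ?_⟩
  · have hsub : IsBoundedMeasurable fun x => Φ (sample n x) - m :=
      ⟨(hΦ.comp (measurable_sample n)).sub_const m, M + |m|, fun x =>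
        (abs_sub _ _).trans (by linarith [hM (sample n x)])⟩
    exact (hsub.exp_mul t).integrable P
  · have h := integral_exp_le hP hp hΓ hF (d := d) (n := n)
      (fun k => by simp only [hd]; split_ifs <;> simp [hδ])
      (fun k hk => if_neg (by omega)) hFlip hSd t
    rw [integral_sampleOfPast hP hΦ] at h
    rw [integral_sampleOfPast hP (Φ := fun s => Real.exp (t * (Φ s - m)))
      (measurable_of_countable _)] at h
    rw [Real.coe_toNNReal _ (by positivity)]
    exact h

end Guessing

namespace Guessing

/-! ### Counting patterns -/

section Counting

variable {A : Type*} {n : ℕ} {D G : Finset ℤ}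

/-- The shifts that keep the window `H` inside `{1, …, n}`. -/
noncomputable def validShifts (n : ℕ) (H : Finset ℤ) : Finset ℕ :=
  {i ∈ Finset.range n | ∀ j ∈ H, j + (i : ℤ) ∈ Finset.Icc (1 : ℤ) n}

open Classical in
/-- The indicator that `b` occurs on `D + i` and `a` on `G + i`. -/
noncomputable def occ (s : Sample A n) (b : D → A) (a : G → A) (i : ℕ) : ℝ :=
  if OccursAt s b (i : ℤ) ∧ OccursAt s a (i : ℤ) then 1 else 0

theorem OccursAt.eq {s : Sample A n} {a a' : G → A} {i : ℤ} (h : OccursAt s a i)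
    (h' : OccursAt s a' i) : a = a' :=
  funext fun j => (h j).2.symm.trans (h' j).2

theorem OccursAt.congr {s s' : Sample A n} {a : G → A} {i : ℤ} (h : OccursAt s a i)
    (hs : ∀ j : Finset.Icc (1 : ℤ) (n : ℤ), (j : ℤ) - i ∈ G → s j = s' j) : OccursAt s' a i := by
  intro j
  obtain ⟨h1, h2⟩ := h j
  exact ⟨h1, by rw [← hs ⟨_, h1⟩ (by simp), h2]⟩

theorem occ_congr {s s' : Sample A n} {b : D → A} {a : G → A} {i : ℕ}
    (hs : ∀ j : Finset.Icc (1 : ℤ) (n : ℤ), (j : ℤ) - i ∈ G ∪ D → s j = s' j) :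
    occ s b a i = occ s' b a i := by
  classical
  have key : ∀ {s s' : Sample A n},
      (∀ j : Finset.Icc (1 : ℤ) (n : ℤ), (j : ℤ) - i ∈ G ∪ D → s j = s' j) →
      OccursAt s b (i : ℤ) ∧ OccursAt s a (i : ℤ) →
        OccursAt s' b (i : ℤ) ∧ OccursAt s' a (i : ℤ) := fun hs h =>
    ⟨h.1.congr fun j hj => hs j (Finset.mem_union_right _ hj),
      h.2.congr fun j hj => hs j (Finset.mem_union_left _ hj)⟩
  unfold occ
  simp only [show (OccursAt s b (i : ℤ) ∧ OccursAt s a (i : ℤ)) =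
    (OccursAt s' b (i : ℤ) ∧ OccursAt s' a (i : ℤ)) from
      propext ⟨key hs, key fun j hj => (hs j hj).symm⟩]

theorem occ_eq_zero {s : Sample A n} {b : D → A} {a : G → A} {i : ℕ} (hi : i ∈ Finset.range n)
    (h : i ∉ validShifts n (G ∪ D)) : occ s b a i = 0 := by
  refine if_neg fun ⟨hb, ha⟩ => h (Finset.mem_filter.2 ⟨hi, fun j hj => ?_⟩)
  rcases Finset.mem_union.1 hj with hj | hj
  · exact (ha ⟨j, hj⟩).1
  · exact (hb ⟨j, hj⟩).1

theorem count_eq_sum_occ (s : Sample A n) (b : D → A) (a : G → A) :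
    (count s b a : ℝ) = ∑ i ∈ validShifts n (G ∪ D), occ s b a i := by
  classical
  rw [count, Nat.cast_sum]
  symm
  refine Finset.sum_subset (Finset.filter_subset _ _) (fun i hi h => occ_eq_zero hi h) |>.trans ?_
  refine Finset.sum_congr rfl fun i _ => ?_
  unfold occ
  split_ifs <;> simp

theorem count_le (s : Sample A n) (b : D → A) (a : G → A) : count s b a ≤ n := by
  classical
  unfold count
  refine (Finset.sum_le_card_nsmul _ _ 1 fun i _ => ?_).trans (by simp)
  split_ifs <;> simp

/-- A window shows only one pattern, so at most one term is nonzero however large `S` is. This is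
the source of independence from the alphabet size. -/
theorem abs_sum_mul_occ_le (s : Sample A n) (b : D → A) {σ : (G → A) → ℝ} (hσ : ∀ a, |σ a| ≤ 1)
    (S : Finset (G → A)) (i : ℕ) : |∑ a ∈ S, σ a * occ s b a i| ≤ 1 := by
  classical
  by_cases h : ∃ a ∈ S, OccursAt s b (i : ℤ) ∧ OccursAt s a (i : ℤ)
  · obtain ⟨a, haS, ha⟩ := h
    rw [Finset.sum_eq_single_of_mem a haS fun a' _ hne => ?_]
    · simpa [occ, ha] using hσ a
    · rw [occ, if_neg fun h' => hne (h'.2.eq ha.2), mul_zero]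
  · push Not at h
    rw [Finset.sum_eq_zero fun a ha => ?_]
    · simp
    · rw [occ, if_neg fun h' => h a ha h'.1 h'.2, mul_zero]

/-- The number of admissible shifts whose window contains `j`. -/
noncomputable def coverage (n : ℕ) (H : Finset ℤ) (j : ℤ) : ℕ :=
  ((validShifts n H).filter fun i : ℕ => j - (i : ℤ) ∈ H).card

theorem coverage_le_card (n : ℕ) (H : Finset ℤ) (j : ℤ) : coverage n H j ≤ H.card := by
  refine Finset.card_le_card_of_injOn (fun i : ℕ => j - (i : ℤ))
    (fun i hi => (Finset.mem_filter.1 hi).2) fun i _ i' _ h => ?_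
  have h : j - (i : ℤ) = j - (i' : ℤ) := h
  omega

theorem sum_coverage_le (n : ℕ) (H : Finset ℤ) :
    ∑ j ∈ Finset.Icc (1 : ℤ) n, coverage n H j ≤ H.card * (validShifts n H).card := by
  simp only [coverage, Finset.card_filter]
  rw [Finset.sum_comm, mul_comm]
  refine Finset.sum_le_card_nsmul _ _ _ fun i _ => ?_
  rw [← Finset.card_filter]
  refine Finset.card_le_card_of_injOn (fun j : ℤ => j - (i : ℤ))
    (fun i hi => (Finset.mem_filter.1 hi).2) fun j _ j' _ h => ?_
  have h : j - (i : ℤ) = j' - (i : ℤ) := h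
  omega

/-- Maximum times sum: each coverage is at most the size of the window, and so is the average over
shifts of the number of positions covered. The factor 4 cancels the division by 4 in the proxy of
`hasSubgaussianMGF_sample`. -/
theorem sum_sq_coverage_le (n : ℕ) (D G : Finset ℤ) :
    ∑ j ∈ Finset.Icc (1 : ℤ) n, (2 * (coverage n (G ∪ D) j : ℝ)) ^ 2 ≤
      4 * (((G.card : ℝ) + D.card) ^ 2 * (validShifts n (G ∪ D)).card) := by
  set H := G ∪ D
  have hK : (H.card : ℝ) ≤ (G.card : ℝ) + D.card := by exact_mod_cast Finset.card_union_le G D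
  have h2 : (∑ j ∈ Finset.Icc (1 : ℤ) n, (coverage n H j : ℝ)) ≤
      H.card * (validShifts n H).card := by exact_mod_cast sum_coverage_le n H
  calc _ ≤ ∑ j ∈ Finset.Icc (1 : ℤ) n, 4 * (H.card : ℝ) * (coverage n H j : ℝ) := by
        refine Finset.sum_le_sum fun j _ => ?_
        have h1 : (coverage n H j : ℝ) ≤ H.card := by exact_mod_cast coverage_le_card n H j
        have h0 : (0 : ℝ) ≤ coverage n H j := by positivity
        nlinarith
    _ = 4 * (H.card : ℝ) * ∑ j ∈ Finset.Icc (1 : ℤ) n, (coverage n H j : ℝ) := by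
        rw [Finset.mul_sum]
    _ ≤ 4 * (H.card : ℝ) * (H.card * (validShifts n H).card) := by gcongr
    _ = 4 * ((H.card : ℝ) ^ 2 * (validShifts n H).card) := by ring
    _ ≤ _ := by gcongr

-- Only shifts whose window contains a changed position are affected, and each of them moves the
-- signed sum between two values in `[-1, 1]`.
open Classical in
theorem sum_mul_count_sub_le (b : D → A) {σ : (G → A) → ℝ} (hσ : ∀ a, |σ a| ≤ 1)
    (S : Finset (G → A)) (s s' : Sample A n) :
    ∑ a ∈ S, σ a * (count s b a : ℝ) - ∑ a ∈ S, σ a * (count s' b a : ℝ) ≤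
      ∑ j : Finset.Icc (1 : ℤ) (n : ℤ),
        if s j = s' j then 0 else 2 * (coverage n (G ∪ D) j : ℝ) := by
  have e : ∀ s : Sample A n, ∑ a ∈ S, σ a * (count s b a : ℝ) =
      ∑ i ∈ validShifts n (G ∪ D), ∑ a ∈ S, σ a * occ s b a i := fun s => by
    simp only [count_eq_sum_occ, Finset.mul_sum]
    exact Finset.sum_comm
  have e2 : ∑ j : Finset.Icc (1 : ℤ) (n : ℤ),
        (if s j = s' j then 0 else 2 * (coverage n (G ∪ D) j : ℝ)) =
      ∑ i ∈ validShifts n (G ∪ D), ∑ j : Finset.Icc (1 : ℤ) (n : ℤ),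
        if s j = s' j then 0 else (if (j : ℤ) - (i : ℤ) ∈ G ∪ D then 2 else 0 : ℝ) := by
    rw [Finset.sum_comm]
    refine Finset.sum_congr rfl fun j _ => ?_
    split_ifs with h
    · simp
    · rw [← Finset.sum_filter, Finset.sum_const, coverage, nsmul_eq_mul, mul_comm]
  rw [e, e, e2, ← Finset.sum_sub_distrib]
  refine Finset.sum_le_sum fun i _ => ?_
  have hnn : ∀ j : Finset.Icc (1 : ℤ) (n : ℤ),
      0 ≤ if s j = s' j then 0 else (if (j : ℤ) - (i : ℤ) ∈ G ∪ D then 2 else 0 : ℝ) :=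
    fun j => by split_ifs <;> norm_num
  by_cases h : ∀ j : Finset.Icc (1 : ℤ) (n : ℤ), (j : ℤ) - i ∈ G ∪ D → s j = s' j
  · rw [Finset.sum_congr rfl fun a _ => by rw [occ_congr h], sub_self]
    exact Finset.sum_nonneg fun j _ => hnn j
  · push Not at h
    obtain ⟨j, hj, hne⟩ := h
    refine le_trans ?_ (Finset.single_le_sum (fun j _ => hnn j) (Finset.mem_univ j))
    rw [if_neg hne, if_pos hj]
    have h1 := abs_le.1 (abs_sum_mul_occ_le s b hσ S i)
    have h2 := abs_le.1 (abs_sum_mul_occ_le s' b hσ S i)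
    linarith [h1.2, h2.1]

theorem card_validShifts {H : Finset ℤ} (hmin : IsLeast (↑H : Set ℤ) 1) (hn : diam H ≤ n) :
    ((validShifts n H).card : ℤ) = n - diam H + 1 := by
  have hne : H.Nonempty := ⟨1, hmin.1⟩
  have h1 : H.min' hne = 1 := (Finset.isLeast_min' H hne).unique hmin
  have hd : diam H = H.max' hne := by rw [diam, dif_pos hne, h1]; ring
  have hmax : 1 ≤ H.max' hne := Finset.le_max' H 1 hmin.1
  rw [hd] at hn ⊢
  have : validShifts n H = Finset.range (n - H.max' hne + 1).toNat := by
    ext i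
    simp only [validShifts, Finset.mem_filter, Finset.mem_range, Finset.mem_Icc]
    constructor
    · rintro ⟨-, h⟩
      have := (h _ (Finset.max'_mem H hne)).2
      omega
    · intro h
      refine ⟨by omega, fun j hj => ?_⟩
      have := Finset.le_max' H j hj
      have : 1 ≤ j := hmin.2 hj
      omega
  rw [this, Finset.card_range]
  omega

end Counting

/-! ### Moments of the counts -/

variable {A : Type*} [Countable A] [MeasurableSpace A] [DiscreteMeasurableSpace A]
variable {P : Measure (ℤ → A)} [IsProbabilityMeasure P] {p : Kernel (Pasts A) A} [IsMarkovKernel p]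
variable {n : ℕ} {D G : Finset ℤ}

theorem measurableSet_restrict_eq (H : Finset ℤ) (a : H → A) :
    MeasurableSet {x : ℤ → A | H.restrict x = a} := by
  have h : Measurable fun x : ℤ → A => H.restrict x := H.measurable_restrict
  exact h (measurableSet_singleton a)

theorem isBoundedMeasurable_count (b : D → A) (a : G → A) :
    IsBoundedMeasurable fun x => (count (sample n x) b a : ℝ) := by
  refine ⟨(measurable_of_countable fun s : Sample A n => (count s b a : ℝ)).comp
    (measurable_sample n), n, fun x => ?_⟩
  rw [abs_of_nonneg (by positivity)]
  exact Nat.cast_le.2 (count_le _ _ _)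

theorem integral_count (hP : IsStationary P) (b : D → A) (a : G → A) :
    ∫ x, (count (sample n x) b a : ℝ) ∂P = (validShifts n (G ∪ D)).card * hitProb P b a := by
  classical
  set E : Set (ℤ → A) := {x | G.restrict x = a ∧ D.restrict x = b} with hE
  have hEm : MeasurableSet E := (measurableSet_restrict_eq G a).inter (measurableSet_restrict_eq D b)
  have hocc : ∀ i ∈ validShifts n (G ∪ D), ∀ x : ℤ → A,
      occ (sample n x) b a i = E.indicator (fun _ => (1 : ℝ)) fun k => x (k + i) := by
    intro i hi x
    have hv := (Finset.mem_filter.1 hi).2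
    have hiff : ∀ {H : Finset ℤ} (hH : H ⊆ G ∪ D) (c : H → A),
        OccursAt (sample n x) c (i : ℤ) ↔ H.restrict (fun k => x (k + i)) = c := by
      intro H hH c
      constructor
      · intro h; funext j; exact (h j).2
      · intro h j; exact ⟨hv _ (hH j.2), congrFun h j⟩
    unfold occ
    by_cases hx : (fun k => x (k + i)) ∈ E
    · rw [Set.indicator_of_mem hx, if_pos ⟨(hiff Finset.subset_union_right _).2 hx.2,
        (hiff Finset.subset_union_left _).2 hx.1⟩]
    · rw [Set.indicator_of_notMem hx, if_neg fun h => hx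
        ⟨(hiff Finset.subset_union_left _).1 h.2, (hiff Finset.subset_union_right _).1 h.1⟩]
  have hind : Measurable (E.indicator fun _ => (1 : ℝ)) := measurable_const.indicator hEm
  simp only [count_eq_sum_occ]
  rw [integral_finsetSum]
  · rw [Finset.sum_congr rfl fun i hi => ?_, Finset.sum_const, nsmul_eq_mul]
    rw [integral_congr_ae (ae_of_all _ (hocc i hi)), integral_comp_add_of_isStationary hP hind,
      integral_indicator_const _ hEm, smul_eq_mul, mul_one]
    rfl
  · intro i hi
    refine Integrable.of_bound (C := 1) ((measurable_of_countable fun s : Sample A n =>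
      occ s b a i).comp (measurable_sample n)).aestronglyMeasurable (ae_of_all _ fun x => ?_)
    simp only [occ]; split_ifs <;> simp

theorem hasSubgaussianMGF_sum_count (hP : IsStationary P) (hp : IsLeftCondProb P p)
    (hΓ : 0 < gammaConst p) (b : D → A) {σ : (G → A) → ℝ} (hσ : ∀ a, |σ a| ≤ 1)
    (S : Finset (G → A)) :
    HasSubgaussianMGF (fun x => ∑ a ∈ S, σ a * (count (sample n x) b a : ℝ) -
        ∫ y, ∑ a ∈ S, σ a * (count (sample n y) b a : ℝ) ∂P)
      ((((G.card : ℝ) + D.card) / gammaConst p) ^ 2 *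
        (validShifts n (G ∪ D)).card).toNNReal P := by
  have h := hasSubgaussianMGF_sample hP hp hΓ (n := n)
    (Φ := fun s => ∑ a ∈ S, σ a * (count s b a : ℝ)) (M := ∑ a ∈ S, (n : ℝ))
    (fun s => (Finset.abs_sum_le_sum_abs _ _).trans (Finset.sum_le_sum fun a _ => by
      rw [abs_mul, Nat.abs_cast]
      have h1 : (count s b a : ℝ) ≤ n := by exact_mod_cast count_le s b a
      have h0 : (0 : ℝ) ≤ count s b a := by positivity
      nlinarith [hσ a, abs_nonneg (σ a)]))
    (δ := fun j => 2 * (coverage n (G ∪ D) j : ℝ)) (fun j => by positivity)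
    (fun s s' => sum_mul_count_sub_le b hσ S s s') (sum_sq_coverage_le n D G)
  convert h using 2
  field_simp

theorem IsBoundedMeasurable.add {Ω : Type*} [MeasurableSpace Ω] {f g : Ω → ℝ}
    (hf : IsBoundedMeasurable f) (hg : IsBoundedMeasurable g) :
    IsBoundedMeasurable fun w => f w + g w := by
  obtain ⟨hf, M, hM⟩ := hf
  obtain ⟨hg, N, hN⟩ := hg
  exact ⟨hf.add hg, M + N, fun w => (abs_add_le _ _).trans (add_le_add (hM w) (hN w))⟩

theorem IsBoundedMeasurable.const_mul {Ω : Type*} [MeasurableSpace Ω] {f : Ω → ℝ}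
    (hf : IsBoundedMeasurable f) (c : ℝ) : IsBoundedMeasurable fun w => c * f w := by
  obtain ⟨hf, M, hM⟩ := hf
  exact ⟨hf.const_mul c, |c| * M, fun w => by
    rw [abs_mul]; exact mul_le_mul_of_nonneg_left (hM w) (abs_nonneg c)⟩

theorem IsBoundedMeasurable.sub_const {Ω : Type*} [MeasurableSpace Ω] {f : Ω → ℝ}
    (hf : IsBoundedMeasurable f) (c : ℝ) : IsBoundedMeasurable fun w => f w - c := by
  obtain ⟨hf, M, hM⟩ := hf
  exact ⟨hf.sub_const c, M + |c|, fun w => (abs_sub _ _).trans (by linarith [hM w])⟩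

theorem IsBoundedMeasurable.sq {Ω : Type*} [MeasurableSpace Ω] {f : Ω → ℝ}
    (hf : IsBoundedMeasurable f) : IsBoundedMeasurable fun w => f w ^ 2 := by
  obtain ⟨hf, M, hM⟩ := hf
  exact ⟨hf.pow_const 2, M ^ 2, fun w => by
    rw [abs_pow]; exact pow_le_pow_left₀ (abs_nonneg _) (hM w) 2⟩

/-- If all signed sums of the `z a` have second moment at most `C`, then so has the family: average
over the signs. -/
theorem sum_integral_sq_le_of_signs {Ω ι : Type*} [MeasurableSpace Ω] {μ : Measure Ω}
    [IsFiniteMeasure μ] {z : ι → Ω → ℝ} (hz : ∀ i, IsBoundedMeasurable (z i)) {C : ℝ}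
    (S : Finset ι) : ∀ Y : Ω → ℝ, IsBoundedMeasurable Y →
      (∀ σ : ι → ℝ, (∀ i, |σ i| ≤ 1) → ∫ ω, (Y ω + ∑ i ∈ S, σ i * z i ω) ^ 2 ∂μ ≤ C) →
      ∫ ω, Y ω ^ 2 ∂μ + ∑ i ∈ S, ∫ ω, z i ω ^ 2 ∂μ ≤ C := by
  classical
  induction S using Finset.induction_on with
  | empty => intro Y _ h; simpa using h (fun _ => 0) (by simp)
  | insert a T ha ih =>
    intro Y hY h
    have key : ∀ c : ℝ, |c| ≤ 1 →
        ∫ ω, (Y ω + c * z a ω) ^ 2 ∂μ + ∑ i ∈ T, ∫ ω, z i ω ^ 2 ∂μ ≤ C := by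
      intro c hc
      refine ih _ (hY.add ((hz a).const_mul c)) fun σ hσ => ?_
      have := h (Function.update σ a c) fun i => by
        by_cases hi : i = a
        · subst hi; simpa using hc
        · simpa [hi] using hσ i
      refine le_of_eq_of_le (integral_congr_ae (ae_of_all _ fun ω => ?_)) this
      dsimp only
      rw [Finset.sum_insert ha, Function.update_self, add_assoc]
      congr 3
      refine Finset.sum_congr rfl fun i hi => ?_
      rw [Function.update_of_ne (ne_of_mem_of_not_mem hi ha)]
    have h1 := key 1 (by simp)
    have h2 := key (-1) (by simp)
    -- Parallelogram identity: averaging over the sign of `z a` removes the cross term.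
    have e : ∫ ω, (Y ω + 1 * z a ω) ^ 2 ∂μ + ∫ ω, (Y ω + -1 * z a ω) ^ 2 ∂μ =
        2 * ∫ ω, Y ω ^ 2 ∂μ + 2 * ∫ ω, z a ω ^ 2 ∂μ := by
      rw [← integral_add ((hY.add ((hz a).const_mul _)).sq.integrable μ)
        ((hY.add ((hz a).const_mul _)).sq.integrable μ), ← integral_const_mul,
        ← integral_const_mul, ← integral_add ((hY.sq.integrable μ).const_mul _)
        (((hz a).sq.integrable μ).const_mul _)]
      congr 1; funext ω; ring
    rw [Finset.sum_insert ha]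
    linarith

/-- Every signed sum of the counts is sub-Gaussian with this proxy, hence has at most this variance;
averaging over the signs leaves the sum of the individual variances. -/
theorem sum_variance_count_le (hP : IsStationary P) (hp : IsLeftCondProb P p)
    (hΓ : 0 < gammaConst p) (b : D → A) (S : Finset (G → A)) :
    ∑ a ∈ S, ∫ x, ((count (sample n x) b a : ℝ) -
        (validShifts n (G ∪ D)).card * hitProb P b a) ^ 2 ∂P ≤
      (((G.card : ℝ) + D.card) / gammaConst p) ^ 2 * (validShifts n (G ∪ D)).card := by
  have hz : ∀ a : G → A, IsBoundedMeasurable fun x => (count (sample n x) b a : ℝ) -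
      (validShifts n (G ∪ D)).card * hitProb P b a := fun a =>
    (isBoundedMeasurable_count b a).sub_const _
  have h := sum_integral_sq_le_of_signs (μ := P) hz (C := (((G.card : ℝ) + D.card) /
    gammaConst p) ^ 2 * (validShifts n (G ∪ D)).card) S (fun _ => 0)
    ⟨measurable_const, 0, by simp⟩ fun σ hσ => ?_
  · simpa using h
  · have h2 := integral_sq_le_of_hasSubgaussianMGF
      (hasSubgaussianMGF_sum_count (n := n) hP hp hΓ b hσ S)
    rw [Real.coe_toNNReal _ (by positivity)] at h2
    refine le_of_eq_of_le (integral_congr_ae (ae_of_all _ fun x => ?_)) h2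
    dsimp only
    rw [integral_finsetSum _ fun a _ => ((isBoundedMeasurable_count b a).integrable P).const_mul _,
      ← Finset.sum_sub_distrib, zero_add]
    congr 1
    refine Finset.sum_congr rfl fun a _ => ?_
    rw [integral_const_mul, integral_count hP, mul_sub]

end Guessing

namespace Guessing

/-! ### Elementary bounds -/

section Basic

variable {A : Type*} [MeasurableSpace A] {P : Measure (ℤ → A)} {D G : Finset ℤ}

theorem hitProb_nonneg (b : D → A) (a : G → A) : 0 ≤ hitProb P b a := measureReal_nonneg

theorem hitProb_le_one [IsProbabilityMeasure P] (b : D → A) (a : G → A) : hitProb P b a ≤ 1 :=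
  measureReal_le_one

theorem margin_le_marginAt (b : D → A) : margin P D G ≤ marginAt P G b :=
  ciInf_le ⟨0, by rintro _ ⟨b, rfl⟩; exact Real.sInf_nonneg fun x hx => hx.1.le⟩ b

theorem marginAt_le_one [IsProbabilityMeasure P] (b : D → A) : marginAt P G b ≤ 1 := by
  rcases Set.eq_empty_or_nonempty {g : ℝ | 0 < g ∧
    ∃ c : G → A, g = missProb P b c - ⨅ a : G → A, missProb P b a} with h | ⟨g, hg⟩
  · rw [marginAt, h]; simp
  · refine (csInf_le ⟨0, fun x hx => hx.1.le⟩ hg).trans ?_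
    obtain ⟨-, c, rfl⟩ := hg
    have h1 : missProb P b c ≤ 1 := measureReal_le_one
    have h2 : 0 ≤ ⨅ a : G → A, missProb P b a := Real.iInf_nonneg fun a => measureReal_nonneg
    linarith

theorem hitProb_sub_le_spread [IsProbabilityMeasure P] (b : D → A) (a c : G → A) :
    hitProb P b a - hitProb P b c ≤ spread P D G := by
  have hne : Nonempty (G → A) := ⟨a⟩
  have ha : ∀ b : D → A, BddAbove (Set.range fun a : G → A => hitProb P b a) := fun b =>
    ⟨1, by rintro _ ⟨a, rfl⟩; exact hitProb_le_one b a⟩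
  have hb : BddBelow (Set.range fun a : G → A => hitProb P b a) :=
    ⟨0, by rintro _ ⟨a, rfl⟩; exact hitProb_nonneg b a⟩
  have h := le_ciSup (f := fun b : D → A =>
    (⨆ a : G → A, hitProb P b a) - ⨅ c : G → A, hitProb P b c) ⟨1, by
      rintro _ ⟨b, rfl⟩
      have h1 : ⨆ a : G → A, hitProb P b a ≤ 1 := ciSup_le fun a => hitProb_le_one b a
      have h2 : 0 ≤ ⨅ c : G → A, hitProb P b c := Real.iInf_nonneg fun c => hitProb_nonneg b c
      dsimp only
      linarith⟩ b
  refine le_trans ?_ h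
  linarith [le_ciSup (ha b) a, ciInf_le hb c]

theorem spread_le_one [IsProbabilityMeasure P] [Nonempty A] : spread P D G ≤ 1 := by
  refine ciSup_le fun b => ?_
  have h1 : ⨆ a : G → A, hitProb P b a ≤ 1 := ciSup_le fun a => hitProb_le_one b a
  have h2 : 0 ≤ ⨅ c : G → A, hitProb P b c := Real.iInf_nonneg fun c => hitProb_nonneg b c
  linarith

end Basic

/-! ### The uniform deviation of the counts -/

section Deviation

variable {A : Type*} [MeasurableSpace A] {P : Measure (ℤ → A)} [IsProbabilityMeasure P]
  {n : ℕ} {D G : Finset ℤ}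

/-- The centred number of occurrences. -/
noncomputable def centredCount (P : Measure (ℤ → A)) (b : D → A) (a : G → A) (s : Sample A n) : ℝ :=
  (count s b a : ℝ) - (validShifts n (G ∪ D)).card * hitProb P b a

/-- The largest excess of a centred count over the centred count of `a₀`. -/
noncomputable def deviation (P : Measure (ℤ → A)) (b : D → A) (a₀ : G → A) (s : Sample A n) : ℝ :=
  ⨆ a : G → A, (centredCount P b a s - centredCount P b a₀ s)

theorem abs_centredCount_le (b : D → A) (a : G → A) (s : Sample A n) :
    |centredCount P b a s| ≤ n + (validShifts n (G ∪ D)).card := by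
  have h1 : (count s b a : ℝ) ≤ n := Nat.cast_le.2 (count_le s b a)
  have h0 : (0 : ℝ) ≤ count s b a := by positivity
  have h2 := hitProb_nonneg (P := P) b a
  have h3 := hitProb_le_one (P := P) b a
  have h4 : (0 : ℝ) ≤ (validShifts n (G ∪ D)).card := by positivity
  have h5 := mul_nonneg h4 h2
  have h6 := mul_le_mul_of_nonneg_left h3 h4
  unfold centredCount
  exact abs_le.2 ⟨by linarith, by linarith⟩

theorem bddAbove_centredCount (b : D → A) (a₀ : G → A) (s : Sample A n) :
    BddAbove (Set.range fun a : G → A => centredCount P b a s - centredCount P b a₀ s) := by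
  refine ⟨2 * (n + (validShifts n (G ∪ D)).card), ?_⟩
  rintro _ ⟨a, rfl⟩
  have h1 := abs_le.1 (abs_centredCount_le (P := P) b a s)
  have h2 := abs_le.1 (abs_centredCount_le (P := P) b a₀ s)
  dsimp only
  linarith [h1.2, h2.1]

theorem le_deviation (b : D → A) (a a₀ : G → A) (s : Sample A n) :
    centredCount P b a s - centredCount P b a₀ s ≤ deviation P b a₀ s :=
  le_ciSup (bddAbove_centredCount b a₀ s) a

theorem deviation_le (b : D → A) (a₀ : G → A) (s : Sample A n) :
    deviation P b a₀ s ≤ 2 * (n + (validShifts n (G ∪ D)).card) := by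
  have : Nonempty (G → A) := ⟨a₀⟩
  refine ciSup_le fun a => ?_
  have h1 := abs_le.1 (abs_centredCount_le (P := P) b a s)
  have h2 := abs_le.1 (abs_centredCount_le (P := P) b a₀ s)
  linarith [h1.2, h2.1]

theorem deviation_nonneg (b : D → A) (a₀ : G → A) (s : Sample A n) : 0 ≤ deviation P b a₀ s := by
  simpa using le_deviation (P := P) b a₀ a₀ s

-- For fixed `a`, the signed-sum estimate applies to the indicator of `a` minus that of `a₀`, so
-- only two patterns are involved; the bound is uniform in `a` and passes to the supremum.
open Classical in
theorem deviation_sub_le (b : D → A) (a₀ : G → A) (s s' : Sample A n) :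
    deviation P b a₀ s - deviation P b a₀ s' ≤ ∑ j : Finset.Icc (1 : ℤ) (n : ℤ),
      if s j = s' j then 0 else 2 * (coverage n (G ∪ D) j : ℝ) := by
  have : Nonempty (G → A) := ⟨a₀⟩
  rw [sub_le_iff_le_add]
  refine ciSup_le fun a => ?_
  have h := sum_mul_count_sub_le b
    (σ := fun c => (if c = a then 1 else 0) - (if c = a₀ then 1 else 0))
    (fun c => by split_ifs <;> norm_num) {a, a₀} s s'
  simp only [sub_mul, Finset.sum_sub_distrib, ite_mul, one_mul, zero_mul, Finset.sum_ite_eq',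
    Finset.mem_insert, Finset.mem_singleton, true_or, or_true, if_true] at h
  have h2 := le_deviation (P := P) b a a₀ s'
  unfold centredCount at h2 ⊢
  linarith

end Deviation

variable {A : Type*} [Countable A] [MeasurableSpace A] [DiscreteMeasurableSpace A]
variable {P : Measure (ℤ → A)} [IsProbabilityMeasure P] {p : Kernel (Pasts A) A} [IsMarkovKernel p]
variable {n : ℕ} {D G : Finset ℤ}

theorem hasSubgaussianMGF_deviation (hP : IsStationary P) (hp : IsLeftCondProb P p)
    (hΓ : 0 < gammaConst p) (b : D → A) (a₀ : G → A) :
    HasSubgaussianMGF (fun x => deviation P b a₀ (sample n x) -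
        ∫ y, deviation P b a₀ (sample n y) ∂P)
      ((((G.card : ℝ) + D.card) / gammaConst p) ^ 2 *
        (validShifts n (G ∪ D)).card).toNNReal P := by
  have h := hasSubgaussianMGF_sample hP hp hΓ (n := n) (Φ := deviation P b a₀)
    (fun s => by
      rw [abs_of_nonneg (deviation_nonneg b a₀ s)]
      exact deviation_le b a₀ s)
    (δ := fun j => 2 * (coverage n (G ∪ D) j : ℝ)) (fun j => by positivity)
    (fun s s' => deviation_sub_le b a₀ s s') (sum_sq_coverage_le n D G)
  convert h using 2
  field_simp

theorem isBoundedMeasurable_centredCount {P : Measure (ℤ → A)} (b : D → A) (a : G → A) :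
    IsBoundedMeasurable fun x => centredCount P b a (sample n x) :=
  (isBoundedMeasurable_count b a).sub_const _

theorem isBoundedMeasurable_deviation (b : D → A) (a₀ : G → A) :
    IsBoundedMeasurable fun x => deviation P b a₀ (sample n x) :=
  ⟨(measurable_of_countable (deviation P b a₀)).comp (measurable_sample n),
    2 * (n + (validShifts n (G ∪ D)).card), fun x => by
      rw [abs_of_nonneg (deviation_nonneg b a₀ _)]
      exact deviation_le b a₀ _⟩

/-- The count of `a₀` is centred, so the mean is that of `sup_a Z a`. This supremum is controlled by
the sum of all squares, whose mean is at most `τ ^ 2`. -/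
theorem integral_deviation_le (hP : IsStationary P) (hp : IsLeftCondProb P p)
    (hΓ : 0 < gammaConst p) (b : D → A) (a₀ : G → A) {τ : ℝ} (hτ : 0 < τ)
    (hτ2 : τ ^ 2 = (((G.card : ℝ) + D.card) / gammaConst p) ^ 2 *
      (validShifts n (G ∪ D)).card) :
    ∫ x, deviation P b a₀ (sample n x) ∂P ≤ τ := by
  have hne : Nonempty (G → A) := ⟨a₀⟩
  set u : (ℤ → A) → ℝ := fun x => deviation P b a₀ (sample n x) + centredCount P b a₀ (sample n x)
    with hu
  have hub : IsBoundedMeasurable u :=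
    (isBoundedMeasurable_deviation b a₀).add (isBoundedMeasurable_centredCount b a₀)
  have hz : ∀ a : G → A, IsBoundedMeasurable fun x => centredCount P b a (sample n x) ^ 2 :=
    fun a => (isBoundedMeasurable_centredCount b a).sq
  have h0 : ∫ x, centredCount P b a₀ (sample n x) ∂P = 0 := by
    unfold centredCount
    rw [integral_sub ((isBoundedMeasurable_count b a₀).integrable P) (integrable_const _),
      integral_count hP]
    simp
  have e : ∫ x, deviation P b a₀ (sample n x) ∂P = ∫ x, u x ∂P := by
    rw [hu, integral_add ((isBoundedMeasurable_deviation b a₀).integrable P)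
      ((isBoundedMeasurable_centredCount b a₀).integrable P), h0, add_zero]
  -- This is `z ≤ τ / 2 + z ^ 2 / (2 * τ)`, with a weight that makes both halves equal to `τ / 2` on
  -- average. `ENNReal` is used because the sum over `a` may be infinite and need not converge
  -- pointwise a priori.
  have hpt : ∀ x, ENNReal.ofReal (u x) ≤ ENNReal.ofReal (τ / 2) +
      ∑' a : G → A, ENNReal.ofReal (1 / (2 * τ) * centredCount P b a (sample n x) ^ 2) := by
    intro x
    have hsup : u x = ⨆ a : G → A, centredCount P b a (sample n x) := by
      have := ciSup_add (bddAbove_centredCount (P := P) b a₀ (sample n x))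
        (centredCount P b a₀ (sample n x))
      simpa [hu, deviation] using this
    set W := ∑' a : G → A, ENNReal.ofReal (1 / (2 * τ) * centredCount P b a (sample n x) ^ 2)
    by_cases hW : W = ⊤
    · simp [hW]
    rw [← ENNReal.ofReal_toReal hW, ← ENNReal.ofReal_add (by positivity) ENNReal.toReal_nonneg]
    refine ENNReal.ofReal_le_ofReal ?_
    rw [hsup]
    refine ciSup_le fun a => ?_
    have h1 : 1 / (2 * τ) * centredCount P b a (sample n x) ^ 2 ≤ W.toReal := by
      rw [← ENNReal.ofReal_le_iff_le_toReal hW]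
      exact ENNReal.le_tsum a
    refine le_trans ?_ (add_le_add_right h1 _)
    set z := centredCount P b a (sample n x)
    have : τ / 2 + 1 / (2 * τ) * z ^ 2 - z = (τ - z) ^ 2 / (2 * τ) := by field_simp; ring
    have h3 : 0 ≤ (τ - z) ^ 2 / (2 * τ) := by positivity
    linarith
  have hlin : ∫⁻ x, ENNReal.ofReal (u x) ∂P ≤ ENNReal.ofReal τ := by
    calc _ ≤ ∫⁻ x, (ENNReal.ofReal (τ / 2) +
          ∑' a : G → A, ENNReal.ofReal (1 / (2 * τ) * centredCount P b a (sample n x) ^ 2)) ∂P :=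
          lintegral_mono hpt
      _ = ENNReal.ofReal (τ / 2) + ∑' a : G → A, ENNReal.ofReal
            (1 / (2 * τ) * ∫ x, centredCount P b a (sample n x) ^ 2 ∂P) := by
          rw [lintegral_add_left measurable_const, lintegral_const, measure_univ, mul_one,
            lintegral_tsum fun a => (((hz a).const_mul _).1.ennreal_ofReal).aemeasurable]
          congr 2; funext a
          rw [← integral_const_mul, ofReal_integral_eq_lintegral_ofReal
            (((hz a).const_mul _).integrable P) (ae_of_all _ fun x => by positivity)]
      _ ≤ ENNReal.ofReal (τ / 2) + ENNReal.ofReal (τ / 2) := by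
          gcongr
          rw [ENNReal.tsum_eq_iSup_sum]
          refine iSup_le fun S => ?_
          rw [← ENNReal.ofReal_sum_of_nonneg fun a _ => by positivity, ← Finset.mul_sum]
          refine ENNReal.ofReal_le_ofReal ?_
          have h := sum_variance_count_le (n := n) hP hp hΓ b S
          rw [← hτ2] at h
          refine (mul_le_mul_of_nonneg_left h (by positivity)).trans (le_of_eq ?_)
          field_simp
      _ = _ := by rw [← ENNReal.ofReal_add (by positivity) (by positivity), add_halves]
  rw [e]
  have h1 : ∫ x, u x ∂P ≤ (∫⁻ x, ENNReal.ofReal (u x) ∂P).toReal := by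
    rw [integral_eq_lintegral_pos_part_sub_lintegral_neg_part (hub.integrable P)]
    linarith [ENNReal.toReal_nonneg (a := ∫⁻ x, ENNReal.ofReal (-u x) ∂P)]
  exact h1.trans (ENNReal.toReal_le_of_le_ofReal hτ.le hlin)

/-! ### Hit and miss probabilities -/

theorem missProb_eq (b : D → A) (c : G → A) :
    missProb P b c = P.real {x | D.restrict x = b} - hitProb P b c := by
  have h := measureReal_inter_add_sdiff (μ := P) (s := {x | D.restrict x = b})
    (measurableSet_restrict_eq G c)
  have e1 : {x : ℤ → A | D.restrict x = b} ∩ {x | G.restrict x = c} =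
      {x | G.restrict x = c ∧ D.restrict x = b} := by ext; simp [and_comm]
  have e2 : {x : ℤ → A | D.restrict x = b} \ {x | G.restrict x = c} =
      {x | G.restrict x ≠ c ∧ D.restrict x = b} := by ext; simp [and_comm]
  rw [e1, e2] at h
  unfold missProb hitProb
  linarith

/-- The hit probabilities are summable over the countable set of patterns, so only finitely many
exceed a given positive one and the supremum is attained. -/
theorem exists_forall_hitProb_le [Nonempty A] (b : D → A) :
    ∃ a₀ : G → A, ∀ a : G → A, hitProb P b a ≤ hitProb P b a₀ := by
  set ν : Measure (G → A) := (P.restrict {x | D.restrict x = b}).map G.restrict with hν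
  have hm : Measurable fun x : ℤ → A => G.restrict x := G.measurable_restrict
  have hνa : ∀ a, hitProb P b a = (ν {a}).toReal := fun a => by
    rw [hν, Measure.map_apply hm (measurableSet_singleton a),
      Measure.restrict_apply (hm (measurableSet_singleton a))]
    rfl
  have hs : Summable fun a : G → A => hitProb P b a := by
    simp only [hνa]
    refine ENNReal.summable_toReal ?_
    have := lintegral_countable' (μ := ν) (fun _ => 1)
    simp only [lintegral_const, one_mul] at this
    rw [← this]
    exact measure_ne_top _ _
  by_cases h : ∃ a₁ : G → A, 0 < hitProb P b a₁
  · obtain ⟨a₁, h₁⟩ := h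
    have hfin : {a : G → A | hitProb P b a₁ ≤ hitProb P b a}.Finite := by
      have := hs.tendsto_cofinite_zero.eventually (gt_mem_nhds h₁)
      simpa [Filter.Eventually, Filter.mem_cofinite, Set.compl_def] using this
    obtain ⟨a₀, ha₀, hmax⟩ := hfin.toFinset.exists_max_image (hitProb P b)
      ⟨a₁, by simp⟩
    refine ⟨a₀, fun a => ?_⟩
    by_cases ha : hitProb P b a₁ ≤ hitProb P b a
    · exact hmax a (by simpa using ha)
    · have : hitProb P b a₁ ≤ hitProb P b a₀ := by simpa using ha₀
      linarith
  · push Not at h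
    exact ⟨Classical.arbitrary _, fun a => (h a).trans (hitProb_nonneg _ _)⟩

theorem iInf_missProb {b : D → A} {a₀ : G → A} (h₀ : ∀ a : G → A, hitProb P b a ≤ hitProb P b a₀) :
    ⨅ a : G → A, missProb P b a = missProb P b a₀ := by
  have : Nonempty (G → A) := ⟨a₀⟩
  refine le_antisymm (ciInf_le ⟨0, ?_⟩ a₀) (le_ciInf fun a => ?_)
  · rintro _ ⟨a, rfl⟩; exact measureReal_nonneg
  · rw [missProb_eq, missProb_eq]; linarith [h₀ a]

theorem marginAt_le {b : D → A} {a₀ a : G → A} (h₀ : ∀ a : G → A, hitProb P b a ≤ hitProb P b a₀)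
    (ha : hitProb P b a < hitProb P b a₀) : marginAt P G b ≤ hitProb P b a₀ - hitProb P b a := by
  refine csInf_le ⟨0, fun x hx => hx.1.le⟩ ⟨by linarith, a, ?_⟩
  rw [iInf_missProb h₀, missProb_eq, missProb_eq]; ring

/-! ### The excess risk -/

theorem cond_real {Ω : Type*} [MeasurableSpace Ω] (μ : Measure Ω) {E : Set Ω}
    (hE : MeasurableSet E) (S : Set Ω) : (μ[|E]).real S = (μ.real E)⁻¹ * μ.real (E ∩ S) := by
  rw [Measure.real, cond_apply hE, ENNReal.toReal_mul, ENNReal.toReal_inv]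
  rfl

theorem prod_real_miss (b : D → A) (g : Sample A n → (G → A)) :
    (P.prod P).real {z | D.restrict z.2 = b ∧ g (sample n z.1) ≠ G.restrict z.2} =
      ∫ x, missProb P b (g (sample n x)) ∂P := by
  have hm : Measurable fun z : (ℤ → A) × (ℤ → A) =>
      (sample n z.1, D.restrict z.2, G.restrict z.2) :=
    ((measurable_sample n).comp measurable_fst).prodMk
      ((D.measurable_restrict.comp measurable_snd).prodMk
        (G.measurable_restrict.comp measurable_snd))
  have hS : MeasurableSet {z : (ℤ → A) × (ℤ → A) |
      D.restrict z.2 = b ∧ g (sample n z.1) ≠ G.restrict z.2} :=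
    hm (Set.to_countable {q : Sample A n × (D → A) × (G → A) | q.2.1 = b ∧ g q.1 ≠ q.2.2}).measurableSet
  rw [Measure.real, Measure.prod_apply hS, ← integral_toReal
    (measurable_measure_prodMk_left hS).aemeasurable (ae_of_all _ fun x => measure_lt_top _ _)]
  refine integral_congr_ae (ae_of_all _ fun x => ?_)
  unfold missProb Measure.real
  dsimp only
  congr 2
  ext y
  simp [and_comm, eq_comm]

/-- Multiplying by the probability of `b` undoes the conditioning, and Fubini uses the independence
of the sample from `Y`. If `b` has probability 0, every hit probability at `b` vanishes too. -/
theorem excessRisk_term_eq {b : D → A} {a₀ : G → A}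
    (h₀ : ∀ a : G → A, hitProb P b a ≤ hitProb P b a₀) (f : Sample A n → (D → A) → (G → A)) :
    (((P.prod P)[|{z | D.restrict z.2 = b}]).real
          {z | f (sample n z.1) (D.restrict z.2) ≠ G.restrict z.2}
        - ⨅ a : G → A, ((P.prod P)[|{z | D.restrict z.2 = b}]).real {z | a ≠ G.restrict z.2})
      * (P.prod P).real {z | D.restrict z.2 = b} =
    ∫ x, (hitProb P b a₀ - hitProb P b (f (sample n x) b)) ∂P := by
  have hD : Measurable fun x : ℤ → A => D.restrict x := D.measurable_restrict
  have hE : MeasurableSet {z : (ℤ → A) × (ℤ → A) | D.restrict z.2 = b} :=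
    (hD.comp measurable_snd) (measurableSet_singleton b)
  have hρ : (P.prod P).real {z | D.restrict z.2 = b} = P.real {x | D.restrict x = b} := by
    have : {z : (ℤ → A) × (ℤ → A) | D.restrict z.2 = b} = Set.univ ×ˢ {x | D.restrict x = b} := by
      ext; simp
    rw [this, Measure.real, Measure.prod_prod, measure_univ, one_mul, Measure.real]
  set ρ := (P.prod P).real {z | D.restrict z.2 = b} with hρdef
  have hmiss : ∫ x, (hitProb P b a₀ - hitProb P b (f (sample n x) b)) ∂P =
      ∫ x, missProb P b (f (sample n x) b) ∂P - missProb P b a₀ := by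
    have hi : Integrable (fun x => missProb P b (f (sample n x) b)) P :=
      IsBoundedMeasurable.integrable ⟨(measurable_of_countable fun s : Sample A n =>
        missProb P b (f s b)).comp (measurable_sample n), 1, fun x => by
          refine (abs_of_nonneg ?_).trans_le ?_
          exacts [measureReal_nonneg, measureReal_le_one]⟩ P
    have : ∫ x, missProb P b (f (sample n x) b) ∂P - missProb P b a₀ =
        ∫ x, (missProb P b (f (sample n x) b) - missProb P b a₀) ∂P := by
      rw [integral_sub hi (integrable_const _)]; simp
    rw [this]
    congr 1; funext x; rw [missProb_eq, missProb_eq]; ring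
  by_cases h : ρ = 0
  · have hz : ∀ a : G → A, hitProb P b a = 0 := fun a =>
      le_antisymm ((measureReal_mono fun x hx => hx.2).trans_eq (hρ.symm.trans h))
        (hitProb_nonneg b a)
    simp [h, hz]
  · have hρ0 : 0 ≤ ρ := measureReal_nonneg
    have e1 : ((P.prod P)[|{z | D.restrict z.2 = b}]).real
        {z | f (sample n z.1) (D.restrict z.2) ≠ G.restrict z.2} =
        ρ⁻¹ * ∫ x, missProb P b (f (sample n x) b) ∂P := by
      rw [cond_real _ hE, ← prod_real_miss b fun s => f s b]
      congr 2
      ext z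
      simp only [Set.mem_inter_iff, Set.mem_ofPred_eq]
      exact and_congr_right fun h => by rw [h]
    have e2 : ∀ a : G → A, ((P.prod P)[|{z | D.restrict z.2 = b}]).real {z | a ≠ G.restrict z.2} =
        missProb P b a * ρ⁻¹ := by
      intro a
      have := prod_real_miss (P := P) (n := n) b fun _ => a
      simp only [integral_const, probReal_univ, one_smul] at this
      rw [cond_real _ hE, ← this, mul_comm]
      rfl
    simp only [e2]
    rw [e1, ← Real.iInf_mul_of_nonneg (inv_nonneg.2 hρ0), iInf_missProb h₀, hmiss]
    field_simp

end Guessing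

/-! ### From deviations of the counts to the risk bound -/

namespace Guessing

theorem card_mul_gap_le_deviation {A : Type*} [MeasurableSpace A] {P : Measure (ℤ → A)}
    [IsProbabilityMeasure P] {n : ℕ} (hn : 0 < n) {D G : Finset ℤ}
    {f : Sample A n → (D → A) → (G → A)} (hf : IsArgmaxEstimator f) (b : D → A) (a₀ : G → A)
    (s : Sample A n) :
    (validShifts n (G ∪ D)).card * (hitProb P b a₀ - hitProb P b (f s b)) ≤
      deviation P b a₀ s := by
  have h1 : (count s b a₀ : ℝ) ≤ count s b (f s b) :=
    (div_le_div_iff_of_pos_right (by exact_mod_cast hn)).1 (hf s b a₀)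
  have h2 := le_deviation (P := P) b (f s b) a₀ s
  unfold centredCount at h2
  linarith

/-- The factor 2 inside the logarithm supplies `2 * κ`, since `4 * log 2 > 2`. The constant 8
absorbs the difference between `M + 1` and `M`, because `t ≤ 1`, and the remaining 7 forces `M` to
be at least 7. -/
theorem sampleSize_bounds {κ q t M : ℝ} (hκ : 0 < κ) (hq : 0 ≤ q) (ht0 : 0 < t) (ht1 : t ≤ 1)
    (h : 4 * (κ * (Real.log 2 + q) + 2) ≤ (M + 1) * t ^ 2) :
    7 ≤ M ∧ 4 * κ * q + 2 * κ ≤ M * t ^ 2 := by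
  have hl2 := Real.log_two_gt_d9
  have ht2 : t ^ 2 ≤ 1 := pow_le_one₀ ht0.le ht1
  have hκq : 0 ≤ κ * q := mul_nonneg hκ.le hq
  have hκl : 0.69 * κ ≤ κ * Real.log 2 := by nlinarith
  have h' : 7 + 4 * κ * q + 2 * κ ≤ M * t ^ 2 := by nlinarith
  refine ⟨?_, by linarith⟩
  by_contra! hM
  have := mul_le_mul_of_nonneg_right hM.le (sq_nonneg t)
  linarith

/-- The exponent requires `M * δ ≥ τ * (1 + r)` with `r = √(2 * q)`; it follows from `(1 + r) ^ 2 ≤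
2 + 2 * r ^ 2`, which is where the coefficients 4 and 2 of the hypothesis come from. -/
theorem chernoff_exponent_le {κ q δ M τ : ℝ} (hκ : 0 < κ) (hq : 0 ≤ q) (hδ : 0 < δ) (hM : 0 < M)
    (hτ : 0 < τ) (hτ2 : τ ^ 2 = κ * M) (h : 4 * κ * q + 2 * κ ≤ M * δ ^ 2) :
    τ ≤ M * δ ∧ -(M * δ - τ) ^ 2 / (2 * τ ^ 2) ≤ -q := by
  set r := Real.sqrt (2 * q) with hr
  have hr2 : r ^ 2 = 2 * q := Real.sq_sqrt (by linarith)
  have hr0 : 0 ≤ r := Real.sqrt_nonneg _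
  have hτr : 0 ≤ τ * r := mul_nonneg hτ.le hr0
  have hkey : τ * (1 + r) ≤ M * δ := by
    refine le_of_sq_le_sq ?_ (mul_nonneg hM.le hδ.le)
    have h1 : (1 + r) ^ 2 ≤ 2 + 4 * q := by nlinarith [sq_nonneg (1 - r)]
    calc (τ * (1 + r)) ^ 2 = κ * M * (1 + r) ^ 2 := by rw [mul_pow, hτ2]
      _ ≤ κ * M * (2 + 4 * q) := mul_le_mul_of_nonneg_left h1 (mul_pos hκ hM).le
      _ = M * (4 * κ * q + 2 * κ) := by ring
      _ ≤ M * (M * δ ^ 2) := mul_le_mul_of_nonneg_left h hM.le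
      _ = _ := by ring
  refine ⟨by linarith, ?_⟩
  rw [div_le_iff₀ (by positivity)]
  have : (τ * r) ^ 2 ≤ (M * δ - τ) ^ 2 := pow_le_pow_left₀ hτr (by linarith) 2
  rw [mul_pow, hr2] at this
  linarith

variable {A : Type*} [Countable A] [MeasurableSpace A] [DiscreteMeasurableSpace A]
variable {P : Measure (ℤ → A)} [IsProbabilityMeasure P] {p : Kernel (Pasts A) A} [IsMarkovKernel p]
variable {n : ℕ} {D G : Finset ℤ}

theorem isBoundedMeasurable_gap (f : Sample A n → (D → A) → (G → A)) (b : D → A) (a₀ : G → A) :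
    IsBoundedMeasurable fun x => hitProb P b a₀ - hitProb P b (f (sample n x) b) :=
  ⟨(measurable_of_countable fun s : Sample A n => hitProb P b a₀ - hitProb P b (f s b)).comp
    (measurable_sample n), 1, fun x => abs_le.2
      ⟨by linarith [hitProb_nonneg (P := P) b a₀, hitProb_le_one (P := P) b (f (sample n x) b)],
        by linarith [hitProb_le_one (P := P) b a₀, hitProb_nonneg (P := P) b (f (sample n x) b)]⟩⟩

/-- Chernoff's bound around the mean, with the mean replaced by its upper bound `τ`; mean bound and
variance proxy are governed by the same `τ`. -/
theorem deviation_tail (hP : IsStationary P) (hp : IsLeftCondProb P p)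
    (hΓ : 0 < gammaConst p) (b : D → A) (a₀ : G → A) {τ : ℝ} (hτ : 0 < τ)
    (hτ2 : τ ^ 2 = (((G.card : ℝ) + D.card) / gammaConst p) ^ 2 *
      (validShifts n (G ∪ D)).card) {v : ℝ} (hv : τ ≤ v) :
    P.real {x | v ≤ deviation P b a₀ (sample n x)} ≤ Real.exp (-(v - τ) ^ 2 / (2 * τ ^ 2)) := by
  have h := (hasSubgaussianMGF_deviation (n := n) hP hp hΓ b a₀).measure_ge_le (sub_nonneg.2 hv)
  rw [← hτ2, Real.coe_toNNReal _ (sq_nonneg τ)] at h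
  refine le_trans (measureReal_mono fun x (hx : v ≤ _) => ?_) h
  have := integral_deviation_le (n := n) hP hp hΓ b a₀ hτ hτ2
  change v - τ ≤ _
  linarith

/-- Bounding the mean gap by the mean deviation. -/
theorem integral_gap_le_of_mean (hP : IsStationary P) (hp : IsLeftCondProb P p)
    (hΓ : 0 < gammaConst p) (hn : 0 < n) (hm : 0 < (validShifts n (G ∪ D)).card)
    {f : Sample A n → (D → A) → (G → A)} (hf : IsArgmaxEstimator f) (b : D → A) (a₀ : G → A)
    {τ : ℝ} (hτ : 0 < τ)
    (hτ2 : τ ^ 2 = (((G.card : ℝ) + D.card) / gammaConst p) ^ 2 *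
      (validShifts n (G ∪ D)).card) {ε : ℝ} (hε : τ ≤ ε * (validShifts n (G ∪ D)).card) :
    ∫ x, (hitProb P b a₀ - hitProb P b (f (sample n x) b)) ∂P ≤ ε := by
  have hm' : (0 : ℝ) < (validShifts n (G ∪ D)).card := by exact_mod_cast hm
  refine le_of_mul_le_mul_right ?_ hm'
  refine le_trans ?_ ((integral_deviation_le hP hp hΓ b a₀ hτ hτ2).trans hε)
  rw [mul_comm, ← integral_const_mul]
  exact integral_mono (((isBoundedMeasurable_gap f b a₀).integrable P).const_mul _)
    ((isBoundedMeasurable_deviation b a₀).integrable P)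
    fun x => card_mul_gap_le_deviation hn hf b a₀ (sample n x)

/-- Bounding the mean gap by the probability that it does not vanish. -/
theorem integral_gap_le_of_margin (hP : IsStationary P) (hp : IsLeftCondProb P p)
    (hΓ : 0 < gammaConst p) (hn : 0 < n)
    {f : Sample A n → (D → A) → (G → A)} (hf : IsArgmaxEstimator f) (b : D → A) {a₀ : G → A}
    (h₀ : ∀ a : G → A, hitProb P b a ≤ hitProb P b a₀) {τ : ℝ} (hτ : 0 < τ)
    (hτ2 : τ ^ 2 = (((G.card : ℝ) + D.card) / gammaConst p) ^ 2 *
      (validShifts n (G ∪ D)).card)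
    (hv : τ ≤ (validShifts n (G ∪ D)).card * margin P D G) :
    ∫ x, (hitProb P b a₀ - hitProb P b (f (sample n x) b)) ∂P ≤ spread P D G *
      Real.exp (-((validShifts n (G ∪ D)).card * margin P D G - τ) ^ 2 / (2 * τ ^ 2)) := by
  set v := (validShifts n (G ∪ D)).card * margin P D G with hvdef
  set E : Set (ℤ → A) := {x | v ≤ deviation P b a₀ (sample n x)} with hE
  have hEm : MeasurableSet E :=
    measurableSet_le measurable_const (isBoundedMeasurable_deviation (P := P) b a₀).1
  have hβ : 0 ≤ spread P D G := by simpa using hitProb_sub_le_spread (P := P) b a₀ a₀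
  refine le_trans ?_ (mul_le_mul_of_nonneg_left (deviation_tail hP hp hΓ b a₀ hτ hτ2 hv) hβ)
  have e : spread P D G * P.real E = ∫ x, E.indicator (fun _ => spread P D G) x ∂P := by
    rw [integral_indicator_const _ hEm, smul_eq_mul, mul_comm]
  rw [e]
  refine integral_mono ((isBoundedMeasurable_gap f b a₀).integrable P)
    ((integrable_const _).indicator hEm) fun x => ?_
  dsimp only
  rcases (h₀ (f (sample n x) b)).eq_or_lt with h | h
  · rw [h, sub_self]
    exact Set.indicator_nonneg (fun _ _ => hβ) x
  · have hx : x ∈ E := by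
      refine le_trans ?_ (card_mul_gap_le_deviation hn hf b a₀ (sample n x))
      exact mul_le_mul_of_nonneg_left ((margin_le_marginAt b).trans (marginAt_le h₀ h))
        (Nat.cast_nonneg _)
    rw [Set.indicator_of_mem hx]
    exact hitProb_sub_le_spread b _ _

end Guessing

theorem mainTheorem1 {A : Type*} [Countable A] [Nontrivial A]
    [MeasurableSpace A] [DiscreteMeasurableSpace A]
    (P : Measure (ℤ → A)) [IsProbabilityMeasure P] (hP : Guessing.IsStationary P)
    (p : Kernel (Guessing.Pasts A) A) [IsMarkovKernel p] (hp : Guessing.IsLeftCondProb P p)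
    (hΓ : 0 < Guessing.gammaConst p)
    (D G : Finset ℤ) (hmin : IsLeast (↑(G ∪ D) : Set ℤ) 1)
    (ε : ℝ) (hε : 0 < ε) (n : ℕ)
    (hn : 4 / (max (ε / 2) (Guessing.margin P D G)) ^ 2 *
          ((((G.card : ℝ) + D.card) / Guessing.gammaConst p) ^ 2 *
              Real.log (2 * Guessing.spread P D G / ε)
            + 4 * ((G.card : ℝ) + D.card) * (1 - Guessing.gammaConst p) / Guessing.gammaConst p
            + 2)
        + (Guessing.diam (G ∪ D) : ℝ) - 2 ≤ n)
    (f : Guessing.Sample A n → (D → A) → (G → A)) (hf : Guessing.IsArgmaxEstimator f) :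
    Guessing.excessRisk P f ≤ min ε (Guessing.spread P D G) := by
  open Guessing in
  refine ciSup_le fun b => ?_
  obtain ⟨a₀, h₀⟩ := exists_forall_hitProb_le (P := P) (G := G) b
  rw [excessRisk_term_eq h₀ f]
  set β := spread P D G with hβ
  set δ := margin P D G with hδ
  set Γ := gammaConst p with hΓdef
  set K : ℝ := (G.card : ℝ) + D.card with hK
  have hgapβ : ∫ x, (hitProb P b a₀ - hitProb P b (f (sample n x) b)) ∂P ≤ β := by
    refine (integral_mono ((isBoundedMeasurable_gap f b a₀).integrable P) (integrable_const β)
      fun x => hitProb_sub_le_spread b _ _).trans_eq (by simp)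
  refine le_min ?_ hgapβ
  by_cases hεβ : β ≤ ε
  · exact hgapβ.trans hεβ
  push Not at hεβ
  have hβ0 : 0 < β := hε.trans hεβ
  have hβ1 : β ≤ 1 := spread_le_one
  have hδ1 : δ ≤ 1 := (margin_le_marginAt b).trans (marginAt_le_one b)
  have hΓ1 : Γ ≤ 1 := gammaConst_le_one
  have hKpos : 0 < K := by
    have h1 : 0 < (G ∪ D).card := Finset.card_pos.2 ⟨1, hmin.1⟩
    have h2 : 0 < G.card + D.card := h1.trans_le (Finset.card_union_le G D)
    rw [hK]; exact_mod_cast h2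
  set κ := (K / Γ) ^ 2 with hκ
  have hκ0 : 0 < κ := by positivity
  set q := Real.log (β / ε) with hq
  have hq0 : 0 < q := Real.log_pos ((one_lt_div hε).2 hεβ)
  have hlog : Real.log (2 * β / ε) = Real.log 2 + q := by
    rw [mul_div_assoc, Real.log_mul two_ne_zero (div_pos hβ0 hε).ne']
  set t := max (ε / 2) δ with ht
  have ht0 : 0 < t := lt_max_of_lt_left (by linarith)
  have ht1 : t ≤ 1 := max_le (by linarith) hδ1
  -- This term only enlarges the required sample size; nonnegativity suffices to discard it.
  have hextra : 0 ≤ 4 * K * (1 - Γ) / Γ :=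
    div_nonneg (mul_nonneg (by positivity) (by linarith)) hΓ.le
  -- The number of admissible shifts; the `- 2` in the sample-size condition makes `M + 1` appear
  -- below.
  set M : ℝ := n - diam (G ∪ D) + 1 with hM
  have hMt : 4 * (κ * (Real.log 2 + q) + 2) ≤ (M + 1) * t ^ 2 := by
    rw [hlog] at hn
    have h1 : 4 / t ^ 2 * (κ * (Real.log 2 + q) + 2) ≤ M + 1 := by
      have : 4 / t ^ 2 * (κ * (Real.log 2 + q) + 2) ≤
          4 / t ^ 2 * (κ * (Real.log 2 + q) + 4 * K * (1 - Γ) / Γ + 2) := by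
        gcongr; linarith
      rw [hM]; linarith
    have h2 := mul_le_mul_of_nonneg_right h1 (sq_nonneg t)
    have h3 : 4 / t ^ 2 * (κ * (Real.log 2 + q) + 2) * t ^ 2 =
        4 * (κ * (Real.log 2 + q) + 2) := by field_simp
    linarith
  obtain ⟨hM7, hMt'⟩ := sampleSize_bounds hκ0 hq0.le ht0 ht1 hMt
  have hdiam : diam (G ∪ D) ≤ n := by
    have : (diam (G ∪ D) : ℝ) ≤ n := by rw [hM] at hM7; linarith
    exact_mod_cast this
  have hcard : ((validShifts n (G ∪ D)).card : ℝ) = M := by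
    have h := card_validShifts hmin hdiam
    rw [hM]
    exact_mod_cast h
  have hcard0 : 0 < (validShifts n (G ∪ D)).card := by
    have : (0 : ℝ) < (validShifts n (G ∪ D)).card := by rw [hcard]; linarith
    exact_mod_cast this
  have hn0 : 0 < n := by
    refine Nat.pos_of_ne_zero ?_
    rintro rfl
    simp [validShifts] at hcard0
  set τ := Real.sqrt (κ * M) with hτ
  have hκM : 0 < κ * M := mul_pos hκ0 (by linarith)
  have hτ0 : 0 < τ := Real.sqrt_pos.2 hκM
  have hτ2 : τ ^ 2 = κ * M := Real.sq_sqrt hκM.le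
  -- A small margin is handled by the mean deviation alone, with slack in the constants. A large one
  -- is handled by the tail, where `q = log (β / ε)` is chosen so that `β * exp (-q) = ε`.
  rcases le_total δ (ε / 2) with hcase | hcase
  · have ht' : t = ε / 2 := max_eq_left hcase
    refine integral_gap_le_of_mean hP hp hΓ hn0 hcard0 hf b a₀ hτ0 (by rw [hτ2, hcard]) ?_
    rw [hcard]
    refine Real.sqrt_le_iff.2 ⟨mul_nonneg hε.le (by linarith), ?_⟩
    rw [ht'] at hMt'
    have hle : κ ≤ M * ε ^ 2 := by
      have : 0 ≤ κ * q := mul_nonneg hκ0.le hq0.le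
      linarith
    calc κ * M ≤ M * ε ^ 2 * M := mul_le_mul_of_nonneg_right hle (by linarith)
      _ = _ := by ring
  · have ht' : t = δ := max_eq_right hcase
    rw [ht'] at hMt'
    have hδ0 : 0 < δ := ht' ▸ ht0
    obtain ⟨hv, hexp⟩ := chernoff_exponent_le hκ0 hq0.le hδ0 (by linarith) hτ0 hτ2 hMt'
    have h := integral_gap_le_of_margin hP hp hΓ hn0 hf b h₀ hτ0 (by rw [hτ2, hcard])
      (by rw [hcard]; exact hv)
    refine h.trans ?_
    rw [hcard]
    calc β * Real.exp (-(M * δ - τ) ^ 2 / (2 * τ ^ 2)) ≤ β * Real.exp (-q) :=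
          mul_le_mul_of_nonneg_left (Real.exp_le_exp.2 hexp) hβ0.le
      _ = ε := by
          rw [Real.exp_neg, hq, Real.exp_log (div_pos hβ0 hε)]
          field_simp
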